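/- Let $(J_x)_{x\in\mathbb{Z}^2}$ be coupling constants with $J_x=J_{-x}\ge 0$ and $\sum_{x\in\mathbb{Z}^2}J_x<\infty$, and let $f:\mathbb{R}/2\pi\mathbb{Z}\to\mathbb{R}$ be even. To each site $u\in\mathbb{Z}^2$ attach an angle $\theta_u\in\mathbb{R}/2\pi\mathbb{Z}$, that is, the $O(2)$ spin $(\cos\theta_u,\sin\theta_u)$. For finite $\Lambda\subset\mathbb{Z}^2$ put $$H_\Lambda(\theta)=-\sum_{\{u,v\}:\,u\ne v,\ \{u,v\}\cap\Lambda\neq\emptyset}J_{u-v}\,f(\theta_u-\theta_v),$$ the sum being over unordered pairs (the inverse temperature is absorbed in $f$). The finite-volume Gibbs measure in $\Lambda$ with boundary condition $\bar\theta$ is the probability measure with density proportional to $e^{-H_\Lambda(\theta)}$ with respect to the product over $u\in\Lambda$ of the Haar measures $d\theta_u$, with $\theta_u=\bar\theta_u$ for $u\notin\Lambda$. An infinite-volume Gibbs measure is a probability measure $\mu$ on $(\mathbb{R}/2\pi\mathbb{Z})^{\mathbb{Z}^2}$ that satisfies the DLR equations $\mu(A)=\int\mu_\Lambda^{\bar\theta}(A)\,d\mu(\bar\theta)$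 for every finite $\Lambda$ and every measurable $A$, where $\mu_\Lambda^{\bar\theta}$ is the finite-volume Gibbs measure. Assume that there are $\alpha>4$ and $J\ge 0$ such that $J_x\le J\|x\|_1^{-\alpha}$ for all $x\ne 0$, and that $f$ is continuous (no smoothness is assumed). Then there exist constants $C>0$ and $c>0$, depending only on $f$ and $(J_x)_x$, such that for every infinite-volume Gibbs measure $\mu$ and every $x\in\mathbb{Z}^2\setminus\{0\}$, $$\bigl|\langle\cos(\theta_0-\theta_x)\rangle_\mu\bigr|\le c\,\|x\|_\infty^{-C}.$$ -/

import Mathlib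

open MeasureTheory
open scoped ENNReal

noncomputable section

/-- The period `2π` is positive (this makes the normalized Haar measure on angles available). -/
instance fact_two_pi_pos : Fact (0 < 2 * Real.pi) := ⟨Real.two_pi_pos⟩

namespace PlanarSpin

/-- Sites of the square lattice `ℤ²`. Mathlib's norm `‖x‖` on this type is the supremum norm. -/
abbrev Site : Type := ℤ × ℤ

/-- Angles, that is, real numbers modulo `2π`; the spin with angle `θ` is `(cos θ, sin θ)`. -/
abbrev Angle : Type := AddCircle (2 * Real.pi)

/-- Spin configurations on `ℤ²`, with the product σ-algebra. -/
abbrev Config : Type := Site → Angle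

/-- The `ℓ¹` norm on `ℤ²`. -/
def oneNorm (x : Site) : ℝ := |(x.1 : ℝ)| + |(x.2 : ℝ)|

/-- The data of a translation-invariant ferromagnetic `O(2)` model on `ℤ²`: coupling constants
`J_{u,v} = J_{u-v} = J_{v-u} ≥ 0` with `∑ J_x < ∞` and an even pair interaction `f` on angles
(the inverse temperature is absorbed in `f`). -/
structure Model where
  /-- the coupling constants -/
  J : Site → ℝ
  /-- the pair interaction -/
  f : Angle → ℝ
  J_nonneg : ∀ x, 0 ≤ J x
  J_neg : ∀ x, J (-x) = J x
  J_summable : Summable J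
  f_even : ∀ t, f (-t) = f t

/-- The unoriented edges `{u, v}`, `u ≠ v`, with at least one endpoint in `Λ`. -/
def edges (Λ : Finset Site) : Set (Sym2 Site) :=
  {e | ¬ e.IsDiag ∧ ∃ u ∈ Λ, u ∈ e}

/-- The contribution `J_{u-v} f(θ_u - θ_v)` of the unoriented edge `{u, v}`. -/
def edgeTerm (M : Model) (θ : Config) : Sym2 Site → ℝ :=
  Sym2.lift ⟨fun u v => M.J (u - v) * M.f (θ u - θ v), fun u v => by
    show M.J (u - v) * M.f (θ u - θ v) = M.J (v - u) * M.f (θ v - θ u)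
    rw [← neg_sub v u, M.J_neg, ← neg_sub (θ v) (θ u), M.f_even]⟩

/-- The Hamiltonian `H_Λ(θ) = - ∑_{{u,v} ∩ Λ ≠ ∅} J_{u-v} f(θ_u - θ_v)`. -/
def hamiltonian (M : Model) (Λ : Finset Site) (θ : Config) : ℝ :=
  - ∑' e : edges Λ, edgeTerm M θ e

/-- The configuration equal to `ζ` on `Λ` and to `η` outside `Λ`. -/
def glue (Λ : Finset Site) (η : Config) (ζ : Λ → Angle) : Config :=
  fun u => if h : u ∈ Λ then ζ ⟨u, h⟩ else η u

/-- The reference measure in `Λ` with boundary condition `η`: independent Haar-distributed angles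
in `Λ`, frozen to `η` outside `Λ`. -/
def reference (Λ : Finset Site) (η : Config) : Measure Config :=
  (Measure.pi fun _ : Λ => (AddCircle.haarAddCircle : Measure Angle)).map (glue Λ η)

/-- The finite-volume Gibbs measure in `Λ` with boundary condition `η`, with density
`e^{-H_Λ} / Z_Λ^η` with respect to the reference measure. -/
def finiteGibbs (M : Model) (Λ : Finset Site) (η : Config) : Measure Config :=
  (reference Λ η).tilted fun θ => - hamiltonian M Λ θ

/-- Infinite-volume Gibbs measures: probability measures satisfying the Dobrushin-Lanford-Ruelle
equations for every finite `Λ`. -/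
def IsGibbs (M : Model) (μ : Measure Config) : Prop :=
  IsProbabilityMeasure μ ∧
    ∀ (Λ : Finset Site) (A : Set Config), MeasurableSet A →
      μ A = ∫⁻ η, finiteGibbs M Λ η A ∂μ

end PlanarSpin

end

/-! Fix a box of radius `r` that does not reach `x`. The mean of `cos (θ 0 - θ x)` in it, as a
function of the outer spins, is almost odd under rotating all spins of the box of radius `2r` by `π`
with the spin at `x` fixed: only couplings longer than `r` notice, at a cost `O(r ^ (-s))`. In
dimension two the rotation can be faded out inside the box of radius `4r` at a second-order energy
cost bounded uniformly in `r`. Comparing a Gibbs weight with its translates by plus and minus this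
rotation (`abs_integral_mul_le_of_shift`) then shows that averaging over the larger box multiplies
the supremum of the almost odd function by some `τ < 1`, up to the error. Iterating over `r = 4 ^ n`
gives geometric decay in `n`, that is a power of `‖x‖`, and the DLR equations carry it to every
Gibbs measure.

The second-order bound needs second differences of the interaction bounded below by `-L * a ^ 2`,
which fails for merely continuous `f`. So `f` is squeezed, `h ≤ f ≤ h + ε`, with `h` semiconvex
(`exists_semiconvex_approx`), and the factors `exp (J * (f - h))` of the edges inside the box are
expanded around `1`. The terms are nonnegative and indexed by edge sets `A`; an additional edge
costs a factor at most `2 * ε * J`, so for small `ε` the set `A` is a subcritical random graph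
(`sum_mul_connWeight_le`). For given `A` the rotation is chosen constant on the clusters of `A`: the
rough factors do not see it, and the smooth ones obey the second-order bound
(`exp_mul_sq_expansionWeight_le`). The extra cost of this rounding is controlled by weighted
connectivities (`shift_cost_le`), and averaging over `A` yields `exists_contraction`. -/

namespace PlanarSpin

/-! ### Contraction from a pair of opposite shifts -/

/-- If `φ` is almost odd under the shifts by `±a` and the weight `w` satisfies a second-order
bound along these shifts, then the weighted integral of `φ` is smaller than the trivial bound. -/
theorem abs_integral_mul_le_of_shift {Ω : Type*} [MeasurableSpace Ω] [AddGroup Ω]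
    [MeasurableAdd Ω] (ν : Measure Ω) [ν.IsAddRightInvariant] {w φ : Ω → ℝ} {a : Ω}
    {m ε Q : ℝ} (hQ0 : 0 ≤ Q) (hw : Integrable w ν) (hw0 : ∀ ζ, 0 ≤ w ζ)
    (hφm : AEStronglyMeasurable φ ν)
    (hφ : ∀ ζ, |φ ζ| ≤ m) (hp : ∀ ζ, |φ (ζ + a) + φ ζ| ≤ ε) (hn : ∀ ζ, |φ (ζ + -a) + φ ζ| ≤ ε)
    (hQ : ∀ ζ, Real.exp (-Q) * w ζ ^ 2 ≤ w (ζ + a) * w (ζ + -a)) :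
    |∫ ζ, φ ζ * w ζ ∂ν| ≤ (m * (1 - Real.exp (-Q / 2) / 2) + ε / 2) * ∫ ζ, w ζ ∂ν := by
  have hint : Integrable (fun ζ => φ ζ * w ζ) ν :=
    hw.bdd_mul hφm (Filter.Eventually.of_forall fun ζ => by simpa using hφ ζ)
  have e1 := integral_add_right_eq_self (μ := ν) (fun ζ => φ ζ * w ζ) a
  have e2 := integral_add_right_eq_self (μ := ν) (fun ζ => φ ζ * w ζ) (-a)
  have w1 := integral_add_right_eq_self (μ := ν) w a
  have w2 := integral_add_right_eq_self (μ := ν) w (-a)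
  have i1 := hint.comp_add_right a
  have i2 := hint.comp_add_right (-a)
  have j1 := hw.comp_add_right a
  have j2 := hw.comp_add_right (-a)
  -- By invariance the integral of this combination is `4 * ∫ φ * w`. Almost oddness turns it into
  -- `φ * (2w - w₊ - w₋)` plus errors, where the translates of `w` cancel part of `w`.
  have key : ∀ ζ, |2 * (φ ζ * w ζ) + φ (ζ + a) * w (ζ + a) + φ (ζ + -a) * w (ζ + -a)|
      ≤ (m * (2 - 2 * Real.exp (-Q / 2))) * w ζ + (m + ε) * w (ζ + a)
        + (m + ε) * w (ζ + -a) := by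
    intro ζ
    have hm : 0 ≤ m := (abs_nonneg _).trans (hφ ζ)
    set x := w ζ
    set y := w (ζ + a)
    set z := w (ζ + -a)
    set q := Real.exp (-Q / 2)
    have hq : Real.exp (-Q) = q ^ 2 := by
      rw [← Real.exp_nat_mul]; congr 1; push_cast; ring
    have hx : 0 ≤ x := hw0 _
    have hy : 0 ≤ y := hw0 _
    have hz : 0 ≤ z := hw0 _
    have hq0 : 0 < q := Real.exp_pos _
    have hq1 : q ≤ 1 := Real.exp_le_one_iff.2 (by linarith)
    have hQ' : (q * x) ^ 2 ≤ y * z := by have := hQ ζ; rw [hq] at this; linarith [mul_pow q x 2]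
    -- Since `y * z ≥ (q * x) ^ 2`, one of `y`, `z` is at least `q * x`; for that one, `|x - y| = x
    -- + y - 2 * min x y` gains `2 * q * x`. Only one direction need be favourable, so the
    -- first-order change of the energy is irrelevant.
    have hmax : |x - y| + |x - z| ≤ 2 * x + y + z - 2 * q * x := by
      have h1 : q * x ≤ y ∨ q * x ≤ z := by
        by_contra! h
        have := mul_lt_mul'' h.1 h.2 hy hz
        nlinarith
      have : q * x ≤ x := by nlinarith
      rcases h1 with h | h
      · rcases abs_cases (x - y) with h2 | h2 <;> rcases abs_cases (x - z) with h3 | h3 <;>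
          linarith
      · rcases abs_cases (x - y) with h2 | h2 <;> rcases abs_cases (x - z) with h3 | h3 <;>
          linarith
    have hb : |φ ζ| ≤ m := hφ ζ
    have h1 : 2 * (φ ζ * x) + φ (ζ + a) * y + φ (ζ + -a) * z
        = φ ζ * (x - y) + φ ζ * (x - z) + (φ (ζ + a) + φ ζ) * y + (φ (ζ + -a) + φ ζ) * z := by
      ring
    rw [h1]
    have t1 : |φ ζ * (x - y)| ≤ m * |x - y| := by
      rw [abs_mul]; exact mul_le_mul_of_nonneg_right hb (abs_nonneg _)
    have t2 : |φ ζ * (x - z)| ≤ m * |x - z| := by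
      rw [abs_mul]; exact mul_le_mul_of_nonneg_right hb (abs_nonneg _)
    have t3 : |(φ (ζ + a) + φ ζ) * y| ≤ ε * y := by
      rw [abs_mul, abs_of_nonneg hy]; exact mul_le_mul_of_nonneg_right (hp ζ) hy
    have t4 : |(φ (ζ + -a) + φ ζ) * z| ≤ ε * z := by
      rw [abs_mul, abs_of_nonneg hz]; exact mul_le_mul_of_nonneg_right (hn ζ) hz
    have := abs_add_le (φ ζ * (x - y) + φ ζ * (x - z) + (φ (ζ + a) + φ ζ) * y)
      ((φ (ζ + -a) + φ ζ) * z)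
    have := abs_add_le (φ ζ * (x - y) + φ ζ * (x - z)) ((φ (ζ + a) + φ ζ) * y)
    have := abs_add_le (φ ζ * (x - y)) (φ ζ * (x - z))
    have := mul_le_mul_of_nonneg_left hmax hm
    linarith
  have hlin : ∀ {f g h : Ω → ℝ} {c₁ c₂ c₃ : ℝ}, Integrable f ν → Integrable g ν →
      Integrable h ν → ∫ ζ, (c₁ * f ζ + c₂ * g ζ + c₃ * h ζ) ∂ν
        = c₁ * ∫ ζ, f ζ ∂ν + c₂ * ∫ ζ, g ζ ∂ν + c₃ * ∫ ζ, h ζ ∂ν := by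
    intro f g h c₁ c₂ c₃ hf hg hh
    rw [← integral_const_mul, ← integral_const_mul, ← integral_const_mul,
      ← integral_add (hf.const_mul _) (hg.const_mul _),
      ← integral_add (f := fun ζ => c₁ * f ζ + c₂ * g ζ) ((hf.const_mul _).add (hg.const_mul _))
        (hh.const_mul _)]
  have h4 : 4 * ∫ ζ, φ ζ * w ζ ∂ν
      = ∫ ζ, (2 * (φ ζ * w ζ) + φ (ζ + a) * w (ζ + a) + φ (ζ + -a) * w (ζ + -a)) ∂ν := by
    have := hlin (c₁ := 2) (c₂ := 1) (c₃ := 1) hint i1 i2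
    simp only [one_mul] at this
    rw [this, e1, e2]
    ring
  have h5 : |4 * ∫ ζ, φ ζ * w ζ ∂ν| ≤ ∫ ζ, ((m * (2 - 2 * Real.exp (-Q / 2))) * w ζ
      + (m + ε) * w (ζ + a) + (m + ε) * w (ζ + -a)) ∂ν := by
    rw [h4]
    refine (abs_integral_le_integral_abs).trans (integral_mono ?_ ?_ key)
    · exact (((hint.const_mul 2).add i1).add i2).abs
    · exact ((hw.const_mul _).add (j1.const_mul _)).add (j2.const_mul _)
  rw [hlin hw j1 j2, w1, w2, abs_mul, abs_of_pos (by norm_num : (0 : ℝ) < 4)] at h5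
  linarith

/-! ### Connectivities of a subcritical random edge set -/

/-- Connectedness in the graph with edge set `A`. -/
def Conn {V : Type*} (A : Finset (Sym2 V)) : V → V → Prop :=
  Relation.ReflTransGen fun x y => s(x, y) ∈ A

theorem Conn.mono {V : Type*} {A B : Finset (Sym2 V)} (hAB : A ⊆ B) {u v : V}
    (h : Conn A u v) : Conn B u v :=
  Relation.ReflTransGen.mono (p := fun x y => s(x, y) ∈ B) (fun _ _ hxy => hAB hxy) u v h

/-- Cut a path at its last visit to `u`: the remainder after the next edge never uses that edge
again. The induction needs the stronger form in which the remainder avoids every edge at `u`. -/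
theorem Conn.eq_or_exists {V : Type*} [DecidableEq V] {A : Finset (Sym2 V)} {u v : V}
    (h : Conn A u v) : u = v ∨ ∃ y, s(u, y) ∈ A ∧ Conn (A.erase s(u, y)) y v := by
  suffices H : u = v ∨ ∃ y, s(u, y) ∈ A ∧ Conn (A.filter fun e => u ∉ e) y v by
    rcases H with h | ⟨y, hy, h⟩
    · exact Or.inl h
    · refine Or.inr ⟨y, hy, h.mono fun e he => ?_⟩
      rw [Finset.mem_filter] at he
      refine Finset.mem_erase.2 ⟨?_, he.1⟩
      rintro rfl
      exact he.2 (Sym2.mem_mk_left _ _)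
  induction h with
  | refl => exact Or.inl rfl
  | @tail v z _ hvz ih =>
    by_cases hz : u = z
    · exact Or.inl hz
    right
    rcases ih with rfl | ⟨y, hy, hyv⟩
    · exact ⟨z, hvz, Relation.ReflTransGen.refl⟩
    · by_cases hv : u = v
      · subst hv; exact ⟨z, hvz, Relation.ReflTransGen.refl⟩
      · refine ⟨y, hy, hyv.tail ?_⟩
        simp [hvz, hv, hz]

open Classical in
/-- Unnormalized two-point connectivity of the random edge set with weights `Z`. -/
noncomputable def connWeight {V : Type*} (E : Finset (Sym2 V)) (Z : Finset (Sym2 V) → ℝ)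
    (u v : V) : ℝ :=
  ∑ A ∈ E.powerset, if Conn A u v then Z A else 0

theorem connWeight_nonneg {V : Type*} {E : Finset (Sym2 V)} {Z : Finset (Sym2 V) → ℝ}
    (hZ : ∀ A, 0 ≤ Z A) (u v : V) : 0 ≤ connWeight E Z u v :=
  Finset.sum_nonneg fun A _ => by split_ifs <;> simp [hZ]

/-- One-step path expansion: split off the first edge `s(u, y)`, pay `p u y` for erasing it from
`A`, and use that erasing a fixed edge is injective on the sets containing it. No independence of
the edges is needed. -/
theorem connWeight_le {V : Type*} [DecidableEq V] {Λ : Finset V} {E : Finset (Sym2 V)}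
    {Z : Finset (Sym2 V) → ℝ} (hZ : ∀ A, 0 ≤ Z A) (hE : ∀ x y, s(x, y) ∈ E → y ∈ Λ)
    {p : V → V → ℝ} (hp : ∀ x y, 0 ≤ p x y)
    (hZp : ∀ x y A, s(x, y) ∈ E → s(x, y) ∉ A → Z (insert s(x, y) A) ≤ p x y * Z A) (u v : V) :
    connWeight E Z u v ≤ (if u = v then ∑ A ∈ E.powerset, Z A else 0)
      + ∑ y ∈ Λ, p u y * connWeight E Z y v := by
  classical
  have h1 : ∀ A ∈ E.powerset, (if Conn A u v then Z A else 0) ≤ (if u = v then Z A else 0)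
      + ∑ y ∈ Λ, if s(u, y) ∈ A ∧ Conn (A.erase s(u, y)) y v then Z A else 0 := by
    intro A hA
    have hs : ∀ y ∈ Λ, 0 ≤ if s(u, y) ∈ A ∧ Conn (A.erase s(u, y)) y v then Z A else 0 := by
      intro y _; split_ifs <;> simp [hZ]
    have hs' := Finset.sum_nonneg hs
    by_cases h : Conn A u v
    · rw [if_pos h]
      rcases h.eq_or_exists with h | ⟨y, hy, hyv⟩
      · rw [if_pos h]; linarith
      · have h2 := Finset.single_le_sum hs (hE u y (Finset.mem_powerset.1 hA hy))
        rw [if_pos ⟨hy, hyv⟩] at h2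
        have : 0 ≤ if u = v then Z A else 0 := by split_ifs <;> simp [hZ]
        linarith
    · rw [if_neg h]
      have : 0 ≤ if u = v then Z A else 0 := by split_ifs <;> simp [hZ]
      linarith
  refine (Finset.sum_le_sum h1).trans ?_
  rw [Finset.sum_add_distrib, Finset.sum_comm]
  refine add_le_add (le_of_eq ?_) (Finset.sum_le_sum fun y _ => ?_)
  · split_ifs <;> simp
  by_cases he : s(u, y) ∈ E
  · rw [connWeight, Finset.mul_sum]
    set e := s(u, y)
    calc ∑ A ∈ E.powerset, (if e ∈ A ∧ Conn (A.erase e) y v then Z A else 0)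
        = ∑ A ∈ E.powerset.filter (e ∈ ·), (if Conn (A.erase e) y v then Z A else 0) := by
          rw [Finset.sum_filter]
          exact Finset.sum_congr rfl fun A _ => by by_cases h : e ∈ A <;> simp [h]
      _ ≤ ∑ A ∈ E.powerset.filter (e ∈ ·),
            p u y * (if Conn (A.erase e) y v then Z (A.erase e) else 0) := by
          refine Finset.sum_le_sum fun A hA => ?_
          rw [Finset.mem_filter] at hA
          split_ifs
          · have := hZp u y (A.erase e) he (Finset.notMem_erase _ _)
            rwa [Finset.insert_erase hA.2] at this
          · simp
      _ = ∑ B ∈ (E.powerset.filter (e ∈ ·)).image (fun A => A.erase e),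
            p u y * (if Conn B y v then Z B else 0) := by
          rw [Finset.sum_image]
          intro A hA B hB hAB
          have hA' := (Finset.mem_filter.1 hA).2
          have hB' := (Finset.mem_filter.1 hB).2
          simp only at hAB
          rw [← Finset.insert_erase hA', hAB, Finset.insert_erase hB']
      _ ≤ _ := by
          refine Finset.sum_le_sum_of_subset_of_nonneg ?_ fun B _ _ => ?_
          · intro B hB
            obtain ⟨A, hA, rfl⟩ := Finset.mem_image.1 hB
            exact Finset.mem_powerset.2 ((Finset.erase_subset _ _).trans
              (Finset.mem_powerset.1 (Finset.mem_filter.1 hA).1))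
          · exact mul_nonneg (hp _ _) (by split_ifs <;> simp [hZ])
  · rw [Finset.sum_eq_zero]
    · exact mul_nonneg (hp _ _) (connWeight_nonneg hZ _ _)
    · intro A hA
      rw [if_neg]
      exact fun h => he (Finset.mem_powerset.1 hA h.1)

/-- Subcritical connectivities are summable against a submultiplicative weight `d`. -/
theorem sum_mul_connWeight_le {V : Type*} [DecidableEq V] {Λ : Finset V} {E : Finset (Sym2 V)}
    {Z : Finset (Sym2 V) → ℝ} (hZ : ∀ A, 0 ≤ Z A) (hE : ∀ x y, s(x, y) ∈ E → y ∈ Λ)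
    {p : V → V → ℝ} (hp : ∀ x y, 0 ≤ p x y)
    (hZp : ∀ x y A, s(x, y) ∈ E → s(x, y) ∉ A → Z (insert s(x, y) A) ≤ p x y * Z A)
    {d : V → V → ℝ} (hd0 : ∀ x y, 0 ≤ d x y) (hd1 : ∀ x, d x x ≤ 1)
    (hd : ∀ x y z, d x z ≤ d x y * d y z) (hpd : ∀ x, ∑ y ∈ Λ, p x y * d x y ≤ 1 / 2)
    {u : V} (hu : u ∈ Λ) :
    ∑ v ∈ Λ, d u v * connWeight E Z u v ≤ 2 * ∑ A ∈ E.powerset, Z A := by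
  classical
  set S : V → ℝ := fun u => ∑ v ∈ Λ, d u v * connWeight E Z u v with hS
  set Zt := ∑ A ∈ E.powerset, Z A with hZt
  have hZt0 : 0 ≤ Zt := Finset.sum_nonneg fun A _ => hZ A
  have hτ := connWeight_nonneg (E := E) hZ
  -- At a maximizer of `S` the one-step expansion reads `S x ≤ Zt + S x / 2`, with `d` distributed
  -- along the path by submultiplicativity.
  obtain ⟨x, hx, hmax⟩ := Finset.exists_max_image Λ S ⟨u, hu⟩
  have hSx0 : 0 ≤ S x := Finset.sum_nonneg fun v _ => mul_nonneg (hd0 _ _) (hτ _ _)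
  have hrec : S x ≤ Zt + ∑ y ∈ Λ, p x y * d x y * S y := by
    calc S x ≤ ∑ v ∈ Λ, ((if x = v then d x v * Zt else 0)
          + ∑ y ∈ Λ, p x y * d x y * (d y v * connWeight E Z y v)) := by
          refine Finset.sum_le_sum fun v _ => ?_
          refine (mul_le_mul_of_nonneg_left (connWeight_le hZ hE hp hZp x v) (hd0 _ _)).trans ?_
          rw [mul_add, Finset.mul_sum, mul_ite, mul_zero]
          refine add_le_add le_rfl (Finset.sum_le_sum fun y _ => ?_)
          have := mul_le_mul_of_nonneg_right (hd x y v) (mul_nonneg (hp x y) (hτ y v))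
          linarith
      _ ≤ _ := by
          rw [Finset.sum_add_distrib, Finset.sum_comm]
          refine add_le_add ?_ (le_of_eq ?_)
          · rw [Finset.sum_ite_eq, if_pos hx]
            nlinarith [hd1 x]
          · simp only [hS, Finset.mul_sum]
  have h2 : ∑ y ∈ Λ, p x y * d x y * S y ≤ 1 / 2 * S x := by
    calc _ ≤ ∑ y ∈ Λ, p x y * d x y * S x := Finset.sum_le_sum fun y hy =>
          mul_le_mul_of_nonneg_left (hmax y hy) (mul_nonneg (hp _ _) (hd0 _ _))
      _ = (∑ y ∈ Λ, p x y * d x y) * S x := by rw [Finset.sum_mul]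
      _ ≤ _ := mul_le_mul_of_nonneg_right (hpd x) hSx0
  have := hmax u hu
  linarith

end PlanarSpin

/-! ### Edge sums, the potential and finite-volume Gibbs means -/

namespace PlanarSpin

/-- Orienting each edge so that it starts in `Λ` injects `S` into `Λ × Site`. This reduces sums over
unoriented edges to sums over sites. -/
theorem summable_and_tsum_le_of_touching {Λ : Finset Site} {S : Set (Sym2 Site)}
    (hS : ∀ e ∈ S, ∃ u ∈ Λ, u ∈ e) {F : Sym2 Site → ℝ} (hF : ∀ e, 0 ≤ F e)
    (hs : ∀ u ∈ Λ, Summable fun v => F s(u, v)) :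
    (Summable fun e : S => F e) ∧ ∑' e : S, F e ≤ ∑ u ∈ Λ, ∑' v, F s(u, v) := by
  have hS' : ∀ e : S, ∃ p : Λ × Site, s((p.1 : Site), p.2) = (e : Sym2 Site) := by
    rintro ⟨e, he⟩
    obtain ⟨u, hu, hue⟩ := hS e he
    obtain ⟨v, rfl⟩ := hue
    exact ⟨(⟨u, hu⟩, v), rfl⟩
  choose i hi using hS'
  have hinj : Function.Injective i := fun e e' h => Subtype.ext (by rw [← hi e, ← hi e', h])
  set G : Λ × Site → ℝ := fun p => F s((p.1 : Site), p.2)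
  have hG0 : ∀ p, 0 ≤ G p := fun p => hF _
  have hG : Summable G :=
    (summable_prod_of_nonneg hG0).2 ⟨fun u => hs u u.2, Summable.of_finite⟩
  have hcomp : (fun e : S => F e) = G ∘ i := by
    funext e; simp only [G, Function.comp, hi]
  rw [hcomp]
  refine ⟨hG.comp_injective hinj, (tsum_comp_le_tsum_of_inj hG hG0 hinj).trans (le_of_eq ?_)⟩
  rw [hG.tsum_prod, tsum_fintype, ← Finset.sum_coe_sort Λ]

theorem sum_le_of_touching {Λ : Finset Site} {E : Finset (Sym2 Site)}
    (hE : ∀ x y, s(x, y) ∈ E → x ∈ Λ) {F : Sym2 Site → ℝ} (hF : ∀ e, 0 ≤ F e) :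
    ∑ e ∈ E, F e ≤ ∑ u ∈ Λ, ∑ v ∈ Λ, F s(u, v) := by
  have hsub : E ⊆ (Λ ×ˢ Λ).image fun p => s(p.1, p.2) := by
    intro e he
    induction e with
    | h x y =>
      exact Finset.mem_image.2 ⟨(x, y), Finset.mem_product.2
        ⟨hE x y he, hE y x (by rwa [Sym2.eq_swap])⟩, rfl⟩
  calc ∑ e ∈ E, F e ≤ ∑ e ∈ (Λ ×ˢ Λ).image fun p => s(p.1, p.2), F e :=
        Finset.sum_le_sum_of_subset_of_nonneg hsub fun e _ _ => hF e
    _ ≤ ∑ p ∈ Λ ×ˢ Λ, F s(p.1, p.2) := Finset.sum_image_le_of_nonneg fun e _ => hF e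
    _ = _ := Finset.sum_product _ _ _

namespace Model

/-- The coupling constant of an unoriented edge. -/
noncomputable def coupling (M : Model) : Sym2 Site → ℝ :=
  Sym2.lift ⟨fun u v => M.J (u - v), fun u v => by
    show M.J (u - v) = M.J (v - u)
    rw [← neg_sub v u, M.J_neg]⟩

variable {M : Model}

theorem coupling_mk (u v : Site) : M.coupling s(u, v) = M.J (u - v) := rfl

theorem coupling_nonneg (e : Sym2 Site) : 0 ≤ M.coupling e := by
  induction e with
  | h x y => exact M.J_nonneg _

theorem summable_coupling_mk (u : Site) : Summable fun v => M.coupling s(u, v) :=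
  M.J_summable.comp_injective (i := fun v => u - v) fun _ _ h => sub_right_injective h

theorem summable_coupling {Λ : Finset Site} {S : Set (Sym2 Site)}
    (hS : ∀ e ∈ S, ∃ u ∈ Λ, u ∈ e) : Summable fun e : S => M.coupling e :=
  (summable_and_tsum_le_of_touching hS coupling_nonneg fun u _ => summable_coupling_mk u).1

end Model

variable {M : Model} {F : ℝ}

theorem edgeTerm_mk (θ : Config) (u v : Site) :
    edgeTerm M θ s(u, v) = M.J (u - v) * M.f (θ u - θ v) := rfl

theorem abs_edgeTerm_le (hF : ∀ t, |M.f t| ≤ F) (θ : Config) (e : Sym2 Site) :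
    |edgeTerm M θ e| ≤ F * M.coupling e := by
  induction e with
  | h x y =>
    rw [edgeTerm_mk, M.coupling_mk, abs_mul, abs_of_nonneg (M.J_nonneg _), mul_comm]
    exact mul_le_mul_of_nonneg_right (hF _) (M.J_nonneg _)

theorem continuous_edgeTerm (hf : Continuous M.f) (e : Sym2 Site) :
    Continuous fun θ => edgeTerm M θ e := by
  induction e with
  | h x y =>
    simp only [edgeTerm_mk]
    exact continuous_const.mul
      (hf.comp ((continuous_apply x).sub (continuous_apply y)))

theorem exists_bound_of_continuous {f : Angle → ℝ} (hf : Continuous f) :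
    ∃ F, 0 < F ∧ ∀ t, |f t| ≤ F := by
  obtain ⟨C, hC⟩ := isCompact_univ.exists_bound_of_continuousOn hf.continuousOn
  exact ⟨|C| + 1, by positivity, fun t => (hC t trivial).trans (by linarith [le_abs_self C])⟩

theorem summable_edgeTerm (hF : ∀ t, |M.f t| ≤ F) {Λ : Finset Site} {S : Set (Sym2 Site)}
    (hS : ∀ e ∈ S, ∃ u ∈ Λ, u ∈ e) (θ : Config) : Summable fun e : S => edgeTerm M θ e :=
  Summable.of_norm_bounded ((M.summable_coupling hS).mul_left F) fun e => abs_edgeTerm_le hF θ e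

theorem continuous_tsum_edgeTerm (hf : Continuous M.f) {Λ : Finset Site} {S : Set (Sym2 Site)}
    (hS : ∀ e ∈ S, ∃ u ∈ Λ, u ∈ e) : Continuous fun θ => ∑' e : S, edgeTerm M θ e := by
  obtain ⟨F, -, hF⟩ := exists_bound_of_continuous hf
  exact continuous_tsum (fun e => continuous_edgeTerm hf _) ((M.summable_coupling hS).mul_left F)
    fun e θ => abs_edgeTerm_le hF θ e

/-- Minus the Hamiltonian. -/
noncomputable def potential (M : Model) (Λ : Finset Site) (θ : Config) : ℝ :=
  ∑' e : edges Λ, edgeTerm M θ e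

theorem neg_hamiltonian (Λ : Finset Site) (θ : Config) :
    -hamiltonian M Λ θ = potential M Λ θ := neg_neg _

theorem touching_edges {Λ : Finset Site} : ∀ e ∈ edges Λ, ∃ u ∈ Λ, u ∈ e := fun _ h => h.2

theorem continuous_potential (hf : Continuous M.f) (Λ : Finset Site) :
    Continuous (potential M Λ) := continuous_tsum_edgeTerm hf touching_edges

/-- Normalized product Haar measure in `Λ`. -/
noncomputable abbrev haarIn (Λ : Finset Site) : Measure (Λ → Angle) :=
  Measure.pi fun _ : Λ => (AddCircle.haarAddCircle : Measure Angle)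

theorem glue_of_mem {Λ : Finset Site} {u : Site} (hu : u ∈ Λ) (η : Config) (ζ : Λ → Angle) :
    glue Λ η ζ u = ζ ⟨u, hu⟩ := dif_pos hu

theorem glue_of_notMem {Λ : Finset Site} {u : Site} (hu : u ∉ Λ) (η : Config)
    (ζ : Λ → Angle) : glue Λ η ζ u = η u := dif_neg hu

theorem continuous_glue_uncurry (Λ : Finset Site) :
    Continuous fun p : Config × (Λ → Angle) => glue Λ p.1 p.2 := by
  refine continuous_pi fun u => ?_
  by_cases hu : u ∈ Λ
  · simp only [glue_of_mem hu]; fun_prop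
  · simp only [glue_of_notMem hu]; fun_prop

theorem continuous_glue (Λ : Finset Site) (η : Config) : Continuous (glue Λ η) :=
  (continuous_glue_uncurry Λ).comp (Continuous.prodMk_right η)

theorem measurable_glue_uncurry (Λ : Finset Site) :
    Measurable fun p : Config × (Λ → Angle) => glue Λ p.1 p.2 := by
  refine measurable_pi_lambda _ fun u => ?_
  by_cases hu : u ∈ Λ
  · simp only [glue_of_mem hu]; fun_prop
  · simp only [glue_of_notMem hu]; fun_prop

theorem measurable_glue (Λ : Finset Site) (η : Config) : Measurable (glue Λ η) :=
  (measurable_glue_uncurry Λ).comp measurable_prodMk_left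

/-- Continuous functions of the spins in `Λ` are integrable. -/
theorem integrable_haarIn {Λ : Finset Site} {g : (Λ → Angle) → ℝ} (hg : Continuous g) :
    Integrable g (haarIn Λ) := by
  obtain ⟨C, hC⟩ := isCompact_univ.exists_bound_of_continuousOn hg.continuousOn
  exact Integrable.of_bound hg.aestronglyMeasurable C
    (Filter.Eventually.of_forall fun t => hC t trivial)

/-- The unnormalized Gibbs weight of the spins in `Λ`. -/
noncomputable def gibbsWeight (M : Model) (Λ : Finset Site) (η : Config) (ζ : Λ → Angle) : ℝ :=
  Real.exp (potential M Λ (glue Λ η ζ))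

theorem continuous_gibbsWeight (hf : Continuous M.f) (Λ : Finset Site) (η : Config) :
    Continuous (gibbsWeight M Λ η) :=
  Real.continuous_exp.comp ((continuous_potential hf Λ).comp (continuous_glue Λ η))

theorem integrable_gibbsWeight (hf : Continuous M.f) (Λ : Finset Site) (η : Config) :
    Integrable (gibbsWeight M Λ η) (haarIn Λ) := integrable_haarIn (continuous_gibbsWeight hf Λ η)

theorem gibbsWeight_pos (Λ : Finset Site) (η : Config) (ζ : Λ → Angle) :
    0 < gibbsWeight M Λ η ζ := Real.exp_pos _

theorem integral_gibbsWeight_pos (hf : Continuous M.f) (Λ : Finset Site) (η : Config) :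
    0 < ∫ ζ, gibbsWeight M Λ η ζ ∂haarIn Λ :=
  integral_exp_pos (integrable_gibbsWeight hf Λ η)

/-- The expectation in the finite-volume Gibbs measure, as a ratio of integrals. -/
noncomputable def gibbsMean (M : Model) (Λ : Finset Site) (g : Config → ℝ) (η : Config) : ℝ :=
  (∫ ζ, g (glue Λ η ζ) * gibbsWeight M Λ η ζ ∂haarIn Λ) / ∫ ζ, gibbsWeight M Λ η ζ ∂haarIn Λ

theorem integral_reference {Λ : Finset Site} {g : Config → ℝ} (hg : Measurable g) (η : Config) :
    ∫ θ, g θ ∂reference Λ η = ∫ ζ, g (glue Λ η ζ) ∂haarIn Λ :=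
  integral_map (measurable_glue Λ η).aemeasurable hg.aestronglyMeasurable

instance isProbabilityMeasure_reference (Λ : Finset Site) (η : Config) :
    IsProbabilityMeasure (reference Λ η) :=
  Measure.isProbabilityMeasure_map (measurable_glue Λ η).aemeasurable

theorem integrable_exp_hamiltonian (hf : Continuous M.f) (Λ : Finset Site) (η : Config) :
    Integrable (fun θ => Real.exp (-hamiltonian M Λ θ)) (reference Λ η) := by
  simp only [neg_hamiltonian]
  refine (integrable_map_measure (Continuous.aestronglyMeasurable ?_)
    (measurable_glue Λ η).aemeasurable).2 (integrable_gibbsWeight hf Λ η)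
  exact Real.continuous_exp.comp (continuous_potential hf Λ)

theorem isProbabilityMeasure_finiteGibbs (hf : Continuous M.f) (Λ : Finset Site) (η : Config) :
    IsProbabilityMeasure (finiteGibbs M Λ η) :=
  isProbabilityMeasure_tilted (integrable_exp_hamiltonian hf Λ η)

theorem integral_finiteGibbs (hf : Continuous M.f) {Λ : Finset Site} {g : Config → ℝ}
    (hg : Measurable g) (η : Config) :
    ∫ θ, g θ ∂finiteGibbs M Λ η = gibbsMean M Λ g η := by
  have hm : Measurable fun θ => Real.exp (potential M Λ θ) :=
    (Real.continuous_exp.comp (continuous_potential hf Λ)).measurable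
  rw [finiteGibbs, integral_tilted]
  simp only [neg_hamiltonian]
  rw [integral_reference hm, integral_reference, gibbsMean, ← integral_div]
  · refine integral_congr_ae (Filter.Eventually.of_forall fun ζ => ?_)
    simp only [smul_eq_mul, gibbsWeight]
    ring
  · exact (hm.div_const _).smul hg

theorem measurable_finiteGibbs (hf : Continuous M.f) (Λ : Finset Site) :
    Measurable (finiteGibbs M Λ) := by
  have hH : Measurable fun θ => Real.exp (potential M Λ θ) :=
    (Real.continuous_exp.comp (continuous_potential hf Λ)).measurable
  refine Measure.measurable_of_measurable_coe _ fun s hs => ?_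
  have h1 : ∀ η, finiteGibbs M Λ η s = ∫⁻ ζ, s.indicator (fun _ => 1) (glue Λ η ζ) *
      ENNReal.ofReal (gibbsWeight M Λ η ζ / ∫ ζ', gibbsWeight M Λ η ζ' ∂haarIn Λ)
        ∂haarIn Λ := by
    intro η
    rw [finiteGibbs, tilted_apply' _ _ hs, ← lintegral_indicator hs]
    simp only [neg_hamiltonian]
    rw [integral_reference hH, reference, lintegral_map _ (measurable_glue Λ η)]
    · refine lintegral_congr fun ζ => ?_
      by_cases h : glue Λ η ζ ∈ s <;> simp [h, gibbsWeight]
    · exact ((hH.div_const _).ennreal_ofReal).indicator hs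
  simp only [h1]
  have hw : Measurable fun p : Config × (Λ → Angle) => gibbsWeight M Λ p.1 p.2 :=
    hH.comp (measurable_glue_uncurry Λ)
  have hZ : Measurable fun η => ∫ ζ', gibbsWeight M Λ η ζ' ∂haarIn Λ :=
    (hw.stronglyMeasurable.integral_prod_right').measurable
  refine Measurable.lintegral_prod_right' (f := fun p : Config × (Λ → Angle) =>
    s.indicator (fun _ => 1) (glue Λ p.1 p.2) * ENNReal.ofReal
      (gibbsWeight M Λ p.1 p.2 / ∫ ζ', gibbsWeight M Λ p.1 ζ' ∂haarIn Λ)) ?_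
  refine Measurable.mul ?_ (hw.div (hZ.comp measurable_fst)).ennreal_ofReal
  exact (measurable_const.indicator hs).comp (measurable_glue_uncurry Λ)

theorem measurable_gibbsMean (hf : Continuous M.f) (Λ : Finset Site) {g : Config → ℝ}
    (hg : Measurable g) : Measurable (gibbsMean M Λ g) := by
  have hH : Measurable fun θ => Real.exp (potential M Λ θ) :=
    (Real.continuous_exp.comp (continuous_potential hf Λ)).measurable
  have hw : Measurable fun p : Config × (Λ → Angle) => gibbsWeight M Λ p.1 p.2 :=
    hH.comp (measurable_glue_uncurry Λ)
  exact (((hg.comp (measurable_glue_uncurry Λ)).mul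
    hw).stronglyMeasurable.integral_prod_right').measurable.div
    hw.stronglyMeasurable.integral_prod_right'.measurable

theorem abs_gibbsMean_le (hf : Continuous M.f) (Λ : Finset Site) {g : Config → ℝ} {m : ℝ}
    (hg : ∀ θ, |g θ| ≤ m) (η : Config) : |gibbsMean M Λ g η| ≤ m := by
  have hZ := integral_gibbsWeight_pos hf Λ η
  rw [gibbsMean, abs_div, abs_of_pos hZ, div_le_iff₀ hZ, ← integral_const_mul, ← Real.norm_eq_abs]
  refine norm_integral_le_of_norm_le ((integrable_gibbsWeight hf Λ η).const_mul m)
    (Filter.Eventually.of_forall fun ζ => ?_)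
  rw [Real.norm_eq_abs, abs_mul, abs_of_pos (gibbsWeight_pos Λ η ζ)]
  exact mul_le_mul_of_nonneg_right (hg _) (gibbsWeight_pos Λ η ζ).le

/-- The DLR equations say that `μ` is the `bind` of itself with the Gibbs kernel, so a bound uniform
in the boundary condition survives integration. Adding `1` makes `g` nonnegative, so that the `bind`
formula for `lintegral` applies. -/
theorem IsGibbs.integral_le (hf : Continuous M.f) {μ : Measure Config} (hμ : IsGibbs M μ)
    (Λ : Finset Site) {g : Config → ℝ} (hg : Measurable g) (hg1 : ∀ θ, |g θ| ≤ 1) {m : ℝ}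
    (hm : ∀ η, gibbsMean M Λ g η ≤ m) : ∫ θ, g θ ∂μ ≤ m := by
  have := hμ.1
  have hbind : μ = μ.bind (finiteGibbs M Λ) := by
    ext s hs
    rw [Measure.bind_apply hs (measurable_finiteGibbs hf Λ).aemeasurable]
    exact hμ.2 Λ s hs
  have hi : ∀ (ν : Measure Config) [IsProbabilityMeasure ν], Integrable g ν := fun ν _ =>
    Integrable.of_bound hg.aestronglyMeasurable 1 (Filter.Eventually.of_forall hg1)
  have h0 : ∀ θ, 0 ≤ 1 + g θ := fun θ => by linarith [neg_le_of_abs_le (hg1 θ)]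
  have hl : ∀ (ν : Measure Config) [IsProbabilityMeasure ν],
      ∫⁻ θ, ENNReal.ofReal (1 + g θ) ∂ν = ENNReal.ofReal (1 + ∫ θ, g θ ∂ν) := by
    intro ν _
    rw [← ofReal_integral_eq_lintegral_ofReal (f := fun θ => 1 + g θ)
      ((integrable_const 1).add (hi ν)) (Filter.Eventually.of_forall h0),
      integral_add (integrable_const 1) (hi ν)]
    simp
  have hle : ∫⁻ θ, ENNReal.ofReal (1 + g θ) ∂μ ≤ ENNReal.ofReal (1 + m) := by
    rw [hbind, Measure.lintegral_bind (f := fun θ => ENNReal.ofReal (1 + g θ))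
      (measurable_finiteGibbs hf Λ).aemeasurable
      (measurable_const.add hg).ennreal_ofReal.aemeasurable]
    calc _ ≤ ∫⁻ _, ENNReal.ofReal (1 + m) ∂μ := by
          refine lintegral_mono fun η => ?_
          have := isProbabilityMeasure_finiteGibbs hf Λ η
          rw [hl, integral_finiteGibbs hf hg]
          exact ENNReal.ofReal_le_ofReal (by linarith [hm η])
      _ = _ := by simp
  rw [hl μ] at hle
  have hm1 : 0 ≤ 1 + m := by
    have h := abs_gibbsMean_le hf Λ hg1 0
    linarith [hm 0, neg_le_of_abs_le h]
  linarith [(ENNReal.ofReal_le_ofReal_iff hm1).1 hle]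

theorem IsGibbs.abs_integral_le (hf : Continuous M.f) {μ : Measure Config} (hμ : IsGibbs M μ)
    (Λ : Finset Site) {g : Config → ℝ} (hg : Measurable g) (hg1 : ∀ θ, |g θ| ≤ 1) {m : ℝ}
    (hm : ∀ η, |gibbsMean M Λ g η| ≤ m) : |∫ θ, g θ ∂μ| ≤ m := by
  refine abs_le'.2 ⟨hμ.integral_le hf Λ hg hg1 fun η => (abs_le'.1 (hm η)).1, ?_⟩
  rw [← integral_neg]
  refine hμ.integral_le (g := fun θ => -g θ) hf Λ hg.neg
    (fun θ => by rw [abs_neg]; exact hg1 θ) fun η => ?_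
  refine le_trans (le_of_eq ?_) (abs_le'.1 (hm η)).2
  simp only [gibbsMean, neg_mul, integral_neg, neg_div]

end PlanarSpin

namespace PlanarSpin

variable {M : Model} {F : ℝ}

theorem edgeTerm_congr {θ θ' : Config} {e : Sym2 Site} (h : ∀ u ∈ e, θ u = θ' u) :
    edgeTerm M θ e = edgeTerm M θ' e := by
  induction e with
  | h x y => rw [edgeTerm_mk, edgeTerm_mk, h x (by simp), h y (by simp)]

theorem edgeTerm_add_of_const (θ : Config) {a : Config} {x y : Site} (h : a x = a y) :
    edgeTerm M (θ + a) s(x, y) = edgeTerm M θ s(x, y) := by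
  rw [edgeTerm_mk, edgeTerm_mk, Pi.add_apply, Pi.add_apply, h, add_sub_add_right_eq_sub]

/-! ### Consistency of the Gibbs means in nested volumes -/

section Resampling

/-- Replace the spins in `Λ'` by the second argument. -/
def mix (Λ Λ' : Finset Site) (p : (Λ → Angle) × (Λ' → Angle)) : Λ → Angle :=
  fun u => if h : (u : Site) ∈ Λ' then p.2 ⟨u, h⟩ else p.1 u

theorem measurable_mix (Λ Λ' : Finset Site) : Measurable (mix Λ Λ') := by
  refine measurable_pi_lambda _ fun u => ?_
  by_cases h : (u : Site) ∈ Λ'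
  · simp only [mix, h, dite_true]; fun_prop
  · simp only [mix, h, dite_false]; fun_prop

theorem glue_glue {Λ Λ' : Finset Site} (h : Λ' ⊆ Λ) (η : Config) (ζ : Λ → Angle)
    (ζ' : Λ' → Angle) : glue Λ' (glue Λ η ζ) ζ' = glue Λ η (mix Λ Λ' (ζ, ζ')) := by
  funext u
  by_cases hu' : u ∈ Λ'
  · rw [glue_of_mem hu', glue_of_mem (h hu'), mix, dif_pos hu']
  · rw [glue_of_notMem hu']
    by_cases hu : u ∈ Λ
    · rw [glue_of_mem hu, glue_of_mem hu, mix, dif_neg hu']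
    · rw [glue_of_notMem hu, glue_of_notMem hu]

theorem glue_glue_self {Λ : Finset Site} (η : Config) (ζ ζ' : Λ → Angle) :
    glue Λ (glue Λ η ζ) ζ' = glue Λ η ζ' := by
  funext u
  by_cases hu : u ∈ Λ
  · rw [glue_of_mem hu, glue_of_mem hu]
  · rw [glue_of_notMem hu, glue_of_notMem hu, glue_of_notMem hu]

/-- The preimage of a product set is a product set, and the coordinates of the first argument that
are overwritten contribute total mass `1`. -/
theorem measurePreserving_mix {Λ Λ' : Finset Site} (h : Λ' ⊆ Λ) :
    MeasurePreserving (mix Λ Λ') ((haarIn Λ).prod (haarIn Λ')) (haarIn Λ) := by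
  refine ⟨measurable_mix Λ Λ', (Measure.pi_eq fun s hs => ?_).symm⟩
  rw [Measure.map_apply (measurable_mix Λ Λ') (MeasurableSet.univ_pi hs)]
  have hpre : mix Λ Λ' ⁻¹' Set.univ.pi s
      = (Set.univ.pi fun u : Λ => if (u : Site) ∈ Λ' then Set.univ else s u) ×ˢ
        (Set.univ.pi fun u : Λ' => s ⟨u, h u.2⟩) := by
    ext p
    simp only [Set.mem_preimage, Set.mem_pi, Set.mem_univ, forall_true_left, Set.mem_prod]
    constructor
    · intro hp
      refine ⟨fun u => ?_, fun u => ?_⟩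
      · by_cases hu : (u : Site) ∈ Λ'
        · simp [hu]
        · have := hp u
          rw [mix, dif_neg hu] at this
          simpa [hu] using this
      · have := hp ⟨u, h u.2⟩
        rwa [mix, dif_pos u.2] at this
    · rintro ⟨h1, h2⟩ u
      by_cases hu : (u : Site) ∈ Λ'
      · rw [mix, dif_pos hu]; exact h2 ⟨u, hu⟩
      · rw [mix, dif_neg hu]
        have := h1 u
        rwa [if_neg hu] at this
  rw [hpre, Measure.prod_prod, Measure.pi_pi, Measure.pi_pi]
  set k : Site → ℝ≥0∞ := fun u =>
    if hu : u ∈ Λ then (AddCircle.haarAddCircle : Measure Angle) (s ⟨u, hu⟩) else 1 with hk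
  have e1 : ∀ u : Λ, (AddCircle.haarAddCircle : Measure Angle) (s u) = k u := fun u => by
    simp only [hk, u.2, dite_true]
  have e2 : ∀ u : Λ, (AddCircle.haarAddCircle : Measure Angle)
      (if (u : Site) ∈ Λ' then Set.univ else s u) = if (u : Site) ∈ Λ' then 1 else k u := by
    intro u
    split_ifs
    · exact measure_univ
    · exact e1 u
  simp only [e1, e2]
  rw [Finset.prod_coe_sort Λ (fun u => if u ∈ Λ' then 1 else k u), Finset.prod_coe_sort Λ' k,
    Finset.prod_coe_sort Λ k, ← Finset.prod_sdiff h, ← Finset.prod_sdiff h]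
  congr 1
  rw [Finset.prod_congr rfl (g := k) fun u hu => if_neg (Finset.mem_sdiff.1 hu).2,
    Finset.prod_congr rfl (g := fun _ => (1 : ℝ≥0∞)) fun u (hu : u ∈ Λ') => if_pos hu]
  simp

theorem integral_resample {Λ Λ' : Finset Site} (h : Λ' ⊆ Λ) {G : Config → ℝ}
    (hG : Measurable G) {C : ℝ} (hC : ∀ θ, |G θ| ≤ C) (η : Config) :
    ∫ ζ, G (glue Λ η ζ) ∂haarIn Λ
      = ∫ ζ, ∫ ζ', G (glue Λ' (glue Λ η ζ) ζ') ∂haarIn Λ' ∂haarIn Λ := by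
  have hm : Measurable fun ζ => G (glue Λ η ζ) := hG.comp (measurable_glue Λ η)
  rw [← (measurePreserving_mix h).map_eq, integral_map (measurable_mix Λ Λ').aemeasurable
    hm.aestronglyMeasurable, (measurePreserving_mix h).map_eq, integral_prod]
  · simp only [glue_glue h]
  · exact Integrable.of_bound (hm.comp (measurable_mix Λ Λ')).aestronglyMeasurable C
      (Filter.Eventually.of_forall fun p => hC _)

theorem edges_mono {Λ Λ' : Finset Site} (h : Λ' ⊆ Λ) : edges Λ' ⊆ edges Λ :=
  fun _ he => ⟨he.1, let ⟨u, hu, hue⟩ := he.2; ⟨u, h hu, hue⟩⟩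

theorem tsum_edgeTerm_split (hf : Continuous M.f) {Λ : Finset Site} {S T : Set (Sym2 Site)}
    (hS : ∀ e ∈ S, ∃ u ∈ Λ, u ∈ e) (hTS : T ⊆ S) (θ : Config) :
    ∑' e : S, edgeTerm M θ e
      = ∑' e : T, edgeTerm M θ e + ∑' e : (S \ T : Set _), edgeTerm M θ e := by
  obtain ⟨F, -, hF⟩ := exists_bound_of_continuous hf
  have := Summable.tsum_union_disjoint (f := edgeTerm M θ)
    (Set.disjoint_sdiff_right (s := T) (t := S))
    (summable_edgeTerm hF (fun e he => hS e (hTS he)) θ)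
    (summable_edgeTerm hF (fun e (he : e ∈ S \ T) => hS e he.1) θ)
  rwa [Set.union_sdiff_cancel hTS] at this

/-- Consistency of the finite-volume Gibbs measures. -/
theorem gibbsMean_gibbsMean (hf : Continuous M.f) {Λ Λ' : Finset Site} (h : Λ' ⊆ Λ)
    {g : Config → ℝ} (hg : Measurable g) {C : ℝ} (hC : ∀ θ, |g θ| ≤ C) (η : Config) :
    gibbsMean M Λ (gibbsMean M Λ' g) η = gibbsMean M Λ g η := by
  have hcont := continuous_potential hf Λ
  have hH : Measurable fun θ => Real.exp (potential M Λ θ) :=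
    (Real.continuous_exp.comp hcont).measurable
  obtain ⟨P, hP⟩ := isCompact_univ.exists_bound_of_continuousOn
    (Real.continuous_exp.comp hcont).continuousOn
  have hprod : ∀ {k : Config → ℝ}, (∀ θ, |k θ| ≤ C) →
      ∀ θ, |k θ * Real.exp (potential M Λ θ)| ≤ C * P := by
    intro k hk θ
    rw [abs_mul]
    exact mul_le_mul (hk θ) (hP θ trivial) (abs_nonneg _) ((abs_nonneg _).trans (hk θ))
  have hφ := measurable_gibbsMean hf Λ' hg
  simp only [gibbsMean, gibbsWeight]
  congr 1
  have r1 := integral_resample h (hφ.mul hH) (hprod (abs_gibbsMean_le hf Λ' hC)) η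
  have r2 := integral_resample h (hg.mul hH) (hprod hC) η
  simp only [Pi.mul_apply] at r1 r2
  simp only [gibbsMean, gibbsWeight] at r1
  refine r1.trans (Eq.trans ?_ r2.symm)
  refine integral_congr_ae (Filter.Eventually.of_forall fun ζ => ?_)
  simp only
  set θ := glue Λ η ζ
  -- The edges not touching `Λ'` do not see the resampled spins, so `exp V` leaves the inner
  -- integrals and the normalization in `Λ'` cancels.
  set V := ∑' e : (edges Λ \ edges Λ' : Set _), edgeTerm M θ e
  have hV : ∀ ζ', potential M Λ (glue Λ' θ ζ') = potential M Λ' (glue Λ' θ ζ') + V := by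
    intro ζ'
    rw [potential, tsum_edgeTerm_split hf touching_edges (edges_mono h), ← potential]
    congr 1
    refine tsum_congr fun e => edgeTerm_congr fun u hu => glue_of_notMem (fun hu' => ?_) _ _
    exact e.2.2 ⟨e.2.1.1, u, hu', hu⟩
  simp only [hV, Real.exp_add, glue_glue_self, ← mul_assoc]
  rw [integral_mul_const, integral_mul_const, integral_const_mul]
  congr 1
  exact div_mul_cancel₀ _ (integral_gibbsWeight_pos hf Λ' θ).ne'

end Resampling

/-! ### Almost oddness of the mean under a rotation -/

section Antisymmetry

theorem abs_ratio_sub_ratio_le {Ω : Type*} [MeasurableSpace Ω] {ν : Measure Ω} {g w w' : Ω → ℝ}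
    {δ : ℝ} (hδ : 0 ≤ δ) (hw : Integrable w ν) (hw' : Integrable w' ν)
    (hgm : AEStronglyMeasurable g ν) (hg : ∀ ζ, |g ζ| ≤ 1) (hw0 : ∀ ζ, 0 ≤ w ζ)
    (h1 : ∀ ζ, w' ζ ≤ Real.exp δ * w ζ) (h2 : ∀ ζ, w ζ ≤ Real.exp δ * w' ζ)
    (hZ : 0 < ∫ ζ, w ζ ∂ν) (hZ' : 0 < ∫ ζ, w' ζ ∂ν) :
    |(∫ ζ, g ζ * w' ζ ∂ν) / (∫ ζ, w' ζ ∂ν) - (∫ ζ, g ζ * w ζ ∂ν) / ∫ ζ, w ζ ∂ν|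
      ≤ 2 * (Real.exp δ - 1) * Real.exp δ := by
  have hb : ∀ᵐ ζ ∂ν, ‖g ζ‖ ≤ 1 := Filter.Eventually.of_forall hg
  have hgw := hw.bdd_mul hgm hb
  have hgw' := hw'.bdd_mul hgm hb
  set Z := ∫ ζ, w ζ ∂ν
  set Z' := ∫ ζ, w' ζ ∂ν
  set m := (∫ ζ, g ζ * w ζ ∂ν) / Z with hm
  have hmZ : ∫ ζ, g ζ * w ζ ∂ν = m * Z := by rw [hm]; field_simp
  have hδ1 : 1 ≤ Real.exp δ := Real.one_le_exp hδ
  have hm1 : |m| ≤ 1 := by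
    rw [hm, abs_div, abs_of_pos hZ, div_le_one hZ, ← Real.norm_eq_abs]
    refine norm_integral_le_of_norm_le hw (Filter.Eventually.of_forall fun ζ => ?_)
    rw [Real.norm_eq_abs, abs_mul, abs_of_nonneg (hw0 ζ)]
    nlinarith [hg ζ, hw0 ζ]
  have hZZ : Z ≤ Real.exp δ * Z' := by
    rw [← integral_const_mul]; exact integral_mono hw (hw'.const_mul _) h2
  have hkey : (∫ ζ, g ζ * w' ζ ∂ν) - m * Z' = ∫ ζ, (g ζ - m) * (w' ζ - w ζ) ∂ν := by
    have e : (fun ζ => (g ζ - m) * (w' ζ - w ζ))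
        = fun ζ => (g ζ * w' ζ - m * w' ζ) - (g ζ * w ζ - m * w ζ) := by funext ζ; ring
    rw [e, integral_sub (f := fun ζ => g ζ * w' ζ - m * w' ζ)
      (g := fun ζ => g ζ * w ζ - m * w ζ) (hgw'.sub (hw'.const_mul m)) (hgw.sub (hw.const_mul m)),
      integral_sub hgw' (hw'.const_mul m), integral_sub hgw (hw.const_mul m),
      integral_const_mul, integral_const_mul, hmZ]
    ring
  have hbd : |(∫ ζ, g ζ * w' ζ ∂ν) - m * Z'| ≤ 2 * (Real.exp δ - 1) * Z := by
    rw [hkey, ← integral_const_mul, ← Real.norm_eq_abs]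
    refine norm_integral_le_of_norm_le (hw.const_mul _) (Filter.Eventually.of_forall fun ζ => ?_)
    rw [Real.norm_eq_abs, abs_mul, mul_assoc]
    refine mul_le_mul ?_ ?_ (abs_nonneg _) (by norm_num)
    · exact (abs_sub _ _).trans (by linarith [hg ζ])
    · rw [abs_le]
      constructor
      · have := h2 ζ
        have h3 : 0 < Real.exp δ := Real.exp_pos δ
        -- This is `2 - t ≤ 1 / t` for `t = exp δ`; it gives the lower deviation the same constant
        -- `exp δ - 1` as the upper one.
        have h4 : w ζ * (2 - Real.exp δ) ≤ w' ζ := by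
          have h5 : w ζ * (2 - Real.exp δ) * Real.exp δ ≤ w' ζ * Real.exp δ := by
            nlinarith [hw0 ζ, mul_nonneg (hw0 ζ) (sq_nonneg (Real.exp δ - 1))]
          exact le_of_mul_le_mul_right h5 h3
        linarith
      · linarith [h1 ζ]
  have hfin : (∫ ζ, g ζ * w' ζ ∂ν) / Z' - m = ((∫ ζ, g ζ * w' ζ ∂ν) - m * Z') / Z' := by
    field_simp
  rw [hfin, abs_div, abs_of_pos hZ', div_le_iff₀ hZ']
  have : 0 ≤ 2 * (Real.exp δ - 1) := by linarith
  nlinarith [mul_le_mul_of_nonneg_left hZZ this]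

/-- If a shift changes the sign of `g` and the energy in `Λ` by at most `δ`, then it almost changes
the sign of the mean of `g` as a function of the boundary condition. -/
theorem abs_gibbsMean_add_le (hf : Continuous M.f) {Λ : Finset Site} {g : Config → ℝ}
    (hgm : Measurable g) (hg : ∀ θ, |g θ| ≤ 1) {a : Config} (hga : ∀ θ, g (θ + a) = -g θ)
    {δ : ℝ} (hδ : 0 ≤ δ) (hpot : ∀ θ, |potential M Λ (θ + a) - potential M Λ θ| ≤ δ)
    (θ : Config) :
    |gibbsMean M Λ g (θ + a) + gibbsMean M Λ g θ| ≤ 2 * (Real.exp δ - 1) * Real.exp δ := by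
  set a' : Λ → Angle := fun u => a u
  -- Translating the inner spins along with the boundary condition turns the question into one about
  -- two weights with the same boundary condition.
  have hglue : ∀ ζ : Λ → Angle, glue Λ (θ + a) (ζ + a') = glue Λ θ ζ + a := by
    intro ζ; funext u
    by_cases hu : u ∈ Λ
    · rw [glue_of_mem hu, Pi.add_apply, Pi.add_apply, glue_of_mem hu]
    · rw [glue_of_notMem hu, Pi.add_apply, Pi.add_apply, glue_of_notMem hu]
  set w' : (Λ → Angle) → ℝ := fun ζ => gibbsWeight M Λ (θ + a) (ζ + a')
  have hw' : ∀ ζ, w' ζ = Real.exp (potential M Λ (glue Λ θ ζ + a)) := fun ζ => by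
    simp only [w', gibbsWeight, hglue]
  have e1 : ∫ ζ, gibbsWeight M Λ (θ + a) ζ ∂haarIn Λ = ∫ ζ, w' ζ ∂haarIn Λ :=
    (integral_add_right_eq_self (fun ζ => gibbsWeight M Λ (θ + a) ζ) a').symm
  have e2 : ∫ ζ, g (glue Λ (θ + a) ζ) * gibbsWeight M Λ (θ + a) ζ ∂haarIn Λ
      = -∫ ζ, g (glue Λ θ ζ) * w' ζ ∂haarIn Λ := by
    rw [← integral_add_right_eq_self _ a', ← integral_neg]
    refine integral_congr_ae (Filter.Eventually.of_forall fun ζ => ?_)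
    simp only [hglue, hga, w', neg_mul]
  have h := abs_ratio_sub_ratio_le (ν := haarIn Λ) (g := fun ζ => g (glue Λ θ ζ))
    (w := gibbsWeight M Λ θ) (w' := w') hδ (integrable_gibbsWeight hf Λ θ)
    ((integrable_gibbsWeight hf Λ (θ + a)).comp_add_right a')
    (hgm.comp (measurable_glue Λ θ)).aestronglyMeasurable (fun ζ => hg _)
    (fun ζ => (gibbsWeight_pos Λ θ ζ).le)
    (fun ζ => by
      rw [hw', gibbsWeight, ← Real.exp_add]
      exact Real.exp_le_exp.2 (by linarith [(abs_le.1 (hpot (glue Λ θ ζ))).2]))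
    (fun ζ => by
      rw [hw', gibbsWeight, ← Real.exp_add]
      exact Real.exp_le_exp.2 (by linarith [(abs_le.1 (hpot (glue Λ θ ζ))).1]))
    (integral_gibbsWeight_pos hf Λ θ) (e1 ▸ integral_gibbsWeight_pos hf Λ (θ + a))
  rw [gibbsMean, gibbsMean, e1, e2, neg_div, ← abs_neg]
  refine le_of_eq_of_le ?_ h
  congr 1
  ring

/-- A rotation constant on `B` leaves angle differences inside `B` unchanged, so only edges from `Λ`
out of `B` contribute, each at most `2 * F * J`. -/
theorem abs_potential_add_sub_le (hF : ∀ t, |M.f t| ≤ F) {Λ : Finset Site}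
    {B : Finset Site} {a : Config} (hΛB : Λ ⊆ B) (ha : ∀ u ∈ B, ∀ v ∈ B, a u = a v)
    (θ : Config) : |potential M Λ (θ + a) - potential M Λ θ|
      ≤ ∑ u ∈ Λ, ∑' v, if v ∈ B then 0 else 2 * F * M.J (u - v) := by
  classical
  have hF0 : 0 ≤ F := (abs_nonneg _).trans (hF 0)
  set G : Sym2 Site → ℝ := fun e => if ∀ v ∈ e, v ∈ B then 0 else 2 * F * M.coupling e with hG
  have hG0 : ∀ e, 0 ≤ G e := fun e => by
    simp only [hG]
    split_ifs
    · exact le_rfl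
    · exact mul_nonneg (by linarith) (M.coupling_nonneg e)
  have hGle : ∀ e, G e ≤ 2 * F * M.coupling e := fun e => by
    simp only [hG]
    split_ifs
    · exact mul_nonneg (by linarith) (M.coupling_nonneg e)
    · exact le_rfl
  have hGs : ∀ u ∈ Λ, Summable fun v => G s(u, v) := fun u _ =>
    Summable.of_nonneg_of_le (fun v => hG0 _) (fun v => hGle _)
      ((M.summable_coupling_mk u).mul_left _)
  obtain ⟨hs, hle⟩ := summable_and_tsum_le_of_touching (touching_edges (Λ := Λ)) hG0 hGs
  have hdiff : ∀ e : Sym2 Site, |edgeTerm M (θ + a) e - edgeTerm M θ e| ≤ G e := by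
    intro e
    simp only [hG]
    split_ifs with h
    · induction e with
      | h x y =>
        rw [edgeTerm_add_of_const θ (ha x (h x (by simp)) y (h y (by simp))), sub_self, abs_zero]
    · refine (abs_sub _ _).trans ?_
      linarith [abs_edgeTerm_le hF (θ + a) e, abs_edgeTerm_le hF θ e]
  rw [potential, potential, ← (summable_edgeTerm hF touching_edges (θ + a)).tsum_sub
    (summable_edgeTerm hF touching_edges θ), ← Real.norm_eq_abs]
  refine (tsum_of_norm_bounded hs.hasSum fun e => hdiff e).trans (hle.trans (le_of_eq ?_))
  refine Finset.sum_congr rfl fun u hu => tsum_congr fun v => ?_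
  simp only [hG, Sym2.mem_iff, forall_eq_or_imp, forall_eq, hΛB hu, true_and, M.coupling_mk]

end Antisymmetry

/-! ### Semiconvex approximation of the interaction -/

section Smoothing

/-- Even continuous functions on the circle are approximated from below by even continuous
semiconvex functions. -/
theorem exists_semiconvex_approx {f : Angle → ℝ} (hf : Continuous f) (heven : ∀ t, f (-t) = f t)
    {ε : ℝ} (hε : 0 < ε) :
    ∃ (h : Angle → ℝ) (L : ℝ), 0 ≤ L ∧ Continuous h ∧ (∀ t, h (-t) = h t) ∧
      (∀ t, h t ≤ f t ∧ f t ≤ h t + ε) ∧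
      ∀ (t : Angle) (a : ℝ), -(L * a ^ 2) ≤ h (t + a) + h (t + -a) - 2 * h t := by
  obtain ⟨F, hF0, hF⟩ := exists_bound_of_continuous hf
  have huc := CompactSpace.uniformContinuous_of_continuous hf
  obtain ⟨δ, hδ, hfδ⟩ := Metric.uniformContinuous_iff.1 huc ε hε
  -- With this `L` a displacement `|s| ≥ δ` costs at least `2 * F`, hence never beats `s = 0`;
  -- shorter ones change `f` by less than `ε`.
  set L := 2 * F / δ ^ 2
  have hL : 0 ≤ L := by positivity
  -- The sup-convolution of `f` with a parabola. It satisfies `f ≤ k ≤ f + ε`, so `k - ε` lies below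
  -- `f`.
  set k : Angle → ℝ := fun t => ⨆ s : ℝ, f (t + s) - L * s ^ 2 with hk
  have hbdd : ∀ t : Angle, BddAbove (Set.range fun s : ℝ => f (t + s) - L * s ^ 2) := by
    intro t
    refine ⟨F, ?_⟩
    rintro _ ⟨s, rfl⟩
    have := (abs_le.1 (hF (t + s))).2
    have : 0 ≤ L * s ^ 2 := by positivity
    simp only; linarith
  have hle : ∀ (t : Angle) (s : ℝ), f (t + s) - L * s ^ 2 ≤ k t := fun t s => le_ciSup (hbdd t) s
  refine ⟨fun t => k t - ε, 2 * L, by positivity, ?_, ?_, ?_, ?_⟩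
  · refine Continuous.sub ?_ continuous_const
    rw [Metric.continuous_iff]
    intro t η hη
    obtain ⟨ρ, hρ, hfρ⟩ := Metric.uniformContinuous_iff.1 huc (η / 2) (by linarith)
    have key : ∀ t t' : Angle, dist t t' < ρ → k t ≤ k t' + η / 2 := by
      intro t t' ht
      refine ciSup_le fun s => ?_
      have h1 : dist (f (t + s)) (f (t' + s)) < η / 2 := hfρ (by rwa [dist_add_right])
      rw [Real.dist_eq] at h1
      linarith [(abs_lt.1 h1).2, hle t' s]
    refine ⟨ρ, hρ, fun t' ht' => ?_⟩
    rw [Real.dist_eq, abs_lt]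
    have h1 := key t' t ht'
    have h2 := key t t' (by rwa [dist_comm])
    constructor <;> linarith
  · intro t
    have key : ∀ t, k (-t) ≤ k t := by
      intro t
      refine ciSup_le fun s => ?_
      have := hle t (-s)
      rw [← heven, AddCircle.coe_neg] at this
      rw [show -(t + -(s : Angle)) = -t + s by abel] at this
      rwa [neg_sq] at this
    have h1 := key t
    have h2 := key (-t)
    rw [neg_neg] at h2
    simp only; linarith
  · intro t
    constructor
    · have : k t ≤ f t + ε := by
        refine ciSup_le fun s => ?_
        by_cases hs : |s| < δ
        · have h1 : dist (t + s) t < δ := by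
            rw [dist_eq_norm, add_sub_cancel_left]
            exact (QuotientAddGroup.norm_mk_le_norm).trans_lt hs
          have h2 := hfδ h1
          rw [Real.dist_eq] at h2
          have : 0 ≤ L * s ^ 2 := by positivity
          linarith [(abs_lt.1 h2).2]
        · push Not at hs
          have h1 : 2 * F ≤ L * s ^ 2 := by
            have h2 : δ ^ 2 ≤ s ^ 2 := by rw [← sq_abs s]; gcongr
            calc 2 * F = L * δ ^ 2 := by simp only [L]; field_simp
              _ ≤ _ := by gcongr
          linarith [(abs_le.1 (hF (t + s))).2, (abs_le.1 (hF t)).1]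
      simp only; linarith
    · have := hle t 0
      simp only [AddCircle.coe_zero, add_zero] at this
      simp only; norm_num at this; linarith
  · intro t a
    -- Displacements `s - a` from `t + a` and `s + a` from `t - a` reach the same point `t + s`; the
    -- two parabolas add up to `2 * L * s ^ 2 + 2 * L * a ^ 2`.
    have : k t ≤ (k (t + a) + k (t + -a) + 2 * L * a ^ 2) / 2 := by
      refine ciSup_le fun s => ?_
      have h1 := hle (t + a) (s - a)
      have h2 := hle (t + -a) (s + a)
      rw [AddCircle.coe_sub, show t + (a : Angle) + (s - a) = t + s by abel] at h1
      rw [AddCircle.coe_add, show t + -(a : Angle) + (s + a) = t + s by abel] at h2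
      nlinarith
    simp only; linarith

end Smoothing

end PlanarSpin

namespace PlanarSpin

/-! ### Polynomial weights and moments of the couplings -/

section Growth

/-- A submultiplicative weight of polynomial growth. -/
noncomputable def growth (β : ℝ) (x : Site) : ℝ := (1 + ‖x‖) ^ β

variable {β : ℝ}

theorem growth_pos (x : Site) : 0 < growth β x :=
  Real.rpow_pos_of_pos (by positivity) _

theorem growth_zero : growth β 0 = 1 := by simp [growth]

theorem one_le_growth (hβ : 0 ≤ β) (x : Site) : 1 ≤ growth β x :=
  Real.one_le_rpow (by linarith [norm_nonneg x]) hβ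

theorem growth_add_le (hβ : 0 ≤ β) (x y : Site) : growth β (x + y) ≤ growth β x * growth β y := by
  rw [growth, growth, growth, ← Real.mul_rpow (by positivity) (by positivity)]
  refine Real.rpow_le_rpow (by positivity) ?_ hβ
  nlinarith [norm_add_le x y, norm_nonneg x, norm_nonneg y,
    mul_nonneg (norm_nonneg x) (norm_nonneg y)]

theorem growth_neg (x : Site) : growth β (-x) = growth β x := by rw [growth, growth, norm_neg]

theorem sq_norm_le_growth (hβ : 2 ≤ β) (x : Site) : ‖x‖ ^ 2 ≤ growth β x := by
  have h := norm_nonneg x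
  calc ‖x‖ ^ 2 ≤ (1 + ‖x‖) ^ 2 := by gcongr; linarith
    _ = (1 + ‖x‖) ^ (2 : ℝ) := by norm_cast
    _ ≤ _ := Real.rpow_le_rpow_of_exponent_le (by linarith) hβ

theorem rpow_le_growth (hβ : 0 ≤ β) {ρ : ℝ} (hρ : 0 ≤ ρ) {x : Site} (h : ρ ≤ ‖x‖) :
    ρ ^ β ≤ growth β x := Real.rpow_le_rpow hρ (by linarith) hβ

theorem norm_le_oneNorm (x : Site) : ‖x‖ ≤ oneNorm x := by
  rw [Prod.norm_def, oneNorm]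
  refine max_le ?_ ?_
  · rw [Int.norm_eq_abs]; linarith [abs_nonneg (x.2 : ℝ)]
  · rw [Int.norm_eq_abs]; linarith [abs_nonneg (x.1 : ℝ)]

theorem one_le_norm {x : Site} (hx : x ≠ 0) : 1 ≤ ‖x‖ := by
  rw [Prod.norm_def]
  by_cases h : x.1 = 0
  · have h2 : x.2 ≠ 0 := fun h2 => hx (Prod.ext h h2)
    refine le_max_of_le_right ?_
    rw [Int.norm_eq_abs]; exact_mod_cast Int.one_le_abs h2
  · refine le_max_of_le_left ?_
    rw [Int.norm_eq_abs]; exact_mod_cast Int.one_le_abs h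

theorem summable_norm_rpow {k : ℝ} (hk : 2 < k) : Summable fun x : Site => ‖x‖ ^ (-k) := by
  have h := EisensteinSeries.summable_one_div_norm_rpow hk
  rw [← (finTwoArrowEquiv ℤ).symm.summable_iff] at h
  refine h.congr fun x => ?_
  simp only [Function.comp, finTwoArrowEquiv_symm_apply]
  congr 1
  rw [Prod.norm_def, Pi.norm_def]
  simp [Fin.univ_succ]

/-- The terms are `O(‖x‖ ^ (β - α))`, summable on a two-dimensional lattice once `α - β > 2`. A
moment of order above `2` therefore requires `α > 4`. -/
theorem summable_mul_growth {M : Model} {α J₀ : ℝ} (hJ₀ : 0 ≤ J₀)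
    (hJ : ∀ x : Site, x ≠ 0 → M.J x ≤ J₀ * oneNorm x ^ (-α)) (hβ : 0 ≤ β) (hαβ : 2 + β < α) :
    Summable fun x => M.J x * growth β x := by
  have hs := (summable_norm_rpow (k := α - β) (by linarith)).mul_left (J₀ * 2 ^ β)
  refine Summable.of_norm_bounded_eventually hs ?_
  rw [Filter.eventually_cofinite]
  refine (Set.finite_singleton (0 : Site)).subset fun x hx => ?_
  by_contra hx0
  refine hx ?_
  have h1 := one_le_norm hx0
  have h0 : 0 < ‖x‖ := by linarith
  have hg := growth_pos (β := β) x
  rw [Real.norm_eq_abs, abs_of_nonneg (mul_nonneg (M.J_nonneg x) hg.le)]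
  have hJx : M.J x ≤ J₀ * ‖x‖ ^ (-α) := by
    refine (hJ x hx0).trans (mul_le_mul_of_nonneg_left ?_ hJ₀)
    exact Real.rpow_le_rpow_of_nonpos h0 (norm_le_oneNorm x) (by linarith)
  have hgx : growth β x ≤ 2 ^ β * ‖x‖ ^ β := by
    rw [growth, ← Real.mul_rpow (by norm_num) h0.le]
    exact Real.rpow_le_rpow (by linarith) (by linarith) hβ
  calc M.J x * growth β x ≤ (J₀ * ‖x‖ ^ (-α)) * (2 ^ β * ‖x‖ ^ β) :=
        mul_le_mul hJx hgx hg.le (mul_nonneg hJ₀ (Real.rpow_nonneg h0.le _))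
    _ = J₀ * 2 ^ β * (‖x‖ ^ (-α) * ‖x‖ ^ β) := by ring
    _ = _ := by rw [← Real.rpow_add h0, neg_add_eq_sub, neg_sub]

/-- The moment of the coupling constants for the weight `growth β`. -/
noncomputable def moment (M : Model) (β : ℝ) : ℝ := ∑' x, M.J x * growth β x

variable {M : Model}

theorem moment_nonneg : 0 ≤ moment M β :=
  tsum_nonneg fun x => mul_nonneg (M.J_nonneg x) (growth_pos x).le

theorem hasSum_moment_sub (hs : Summable fun x => M.J x * growth β x) (u : Site) :
    HasSum (fun v => M.J (u - v) * growth β (u - v)) (moment M β) :=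
  (Equiv.subLeft u).hasSum_iff.2 hs.hasSum

theorem sum_mul_growth_le (hs : Summable fun x => M.J x * growth β x) (Λ : Finset Site)
    (u : Site) : ∑ v ∈ Λ, M.J (u - v) * growth β (u - v) ≤ moment M β :=
  sum_le_hasSum Λ (fun _ _ => mul_nonneg (M.J_nonneg _) (growth_pos _).le)
    (hasSum_moment_sub hs u)

theorem coupling_le_moment (hβ : 0 ≤ β) (hs : Summable fun x => M.J x * growth β x) (x : Site) :
    M.J x ≤ moment M β := by
  have h := hs.le_tsum x fun y _ => mul_nonneg (M.J_nonneg y) (growth_pos y).le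
  have := mul_le_mul_of_nonneg_left (one_le_growth hβ x) (M.J_nonneg x)
  rw [moment]; linarith

theorem sum_coupling_le_moment (hβ : 0 ≤ β) (hs : Summable fun x => M.J x * growth β x)
    (Λ : Finset Site) (u : Site) : ∑ v ∈ Λ, M.J (u - v) ≤ moment M β :=
  (Finset.sum_le_sum fun _ _ => le_mul_of_one_le_right (M.J_nonneg _)
    (one_le_growth hβ _)).trans (sum_mul_growth_le hs Λ u)

/-- A Markov inequality for the couplings: a lower bound on the weight over the complement of `P`
bounds the total coupling from `u` to that complement. -/
theorem tsum_coupling_le (hs : Summable fun x => M.J x * growth β x) (u : Site)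
    {P : Site → Prop} [DecidablePred P] {K : ℝ} (hK : 0 ≤ K)
    (h : ∀ v, ¬P v → 1 ≤ K * growth β (u - v)) :
    ∑' v, (if P v then 0 else M.J (u - v)) ≤ K * moment M β := by
  have hle : ∀ v, (if P v then 0 else M.J (u - v)) ≤ K * (M.J (u - v) * growth β (u - v)) := by
    intro v
    split_ifs with hv
    · exact mul_nonneg hK (mul_nonneg (M.J_nonneg _) (growth_pos _).le)
    · nlinarith [mul_le_mul_of_nonneg_left (h v hv) (M.J_nonneg (u - v))]
  have hH := (hasSum_moment_sub hs u).mul_left K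
  rw [← hH.tsum_eq]
  refine Summable.tsum_le_tsum hle (Summable.of_nonneg_of_le (fun _ => ?_) hle hH.summable)
    hH.summable
  split_ifs
  · exact le_rfl
  · exact M.J_nonneg _

end Growth

/-! ### Boxes and the cutoff profile -/

section Box

/-- The box of sites of supremum norm at most `r`. -/
noncomputable def box (r : ℕ) : Finset Site := Finset.Icc (-(r : ℤ), -(r : ℤ)) ((r : ℤ), (r : ℤ))

theorem mem_box {r : ℕ} {u : Site} : u ∈ box r ↔ ‖u‖ ≤ r := by
  rw [box, Finset.mem_Icc, Prod.norm_def, max_le_iff, Int.norm_eq_abs, Int.norm_eq_abs, abs_le,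
    abs_le, Prod.le_def, Prod.le_def]
  norm_cast
  simp only
  omega

theorem zero_mem_box (r : ℕ) : (0 : Site) ∈ box r := mem_box.2 (by simp)

theorem box_mono {r s : ℕ} (h : r ≤ s) : box r ⊆ box s := fun _ hu =>
  mem_box.2 ((mem_box.1 hu).trans (by exact_mod_cast h))

theorem card_box (r : ℕ) : (box r).card = (2 * r + 1) ^ 2 := by
  have h : box r = Finset.Icc (-(r : ℤ)) r ×ˢ Finset.Icc (-(r : ℤ)) r := rfl
  rw [h, Finset.card_product, Int.card_Icc, sq]
  congr 1 <;> omega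

theorem card_box_le {r k : ℕ} (hr : 1 ≤ r) :
    ((box (k * r)).card : ℝ) ≤ (2 * k + 1) ^ 2 * (r : ℝ) ^ 2 := by
  have hr' : (1 : ℝ) ≤ r := by exact_mod_cast hr
  rw [card_box, ← mul_pow]
  push_cast
  have : (0 : ℝ) ≤ k := k.cast_nonneg
  gcongr
  nlinarith

/-- A radial cutoff, equal to `1` in the box of radius `2r` and to `0` off the box of radius
`3r`. -/
noncomputable def cutoff (r : ℕ) (u : Site) : ℝ := max 0 (min 1 (3 - ‖u‖ / r))

theorem cutoff_le_one (r : ℕ) (u : Site) : cutoff r u ≤ 1 :=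
  max_le zero_le_one (min_le_left _ _)

theorem cutoff_eq_one {r : ℕ} (hr : 1 ≤ r) {u : Site} (hu : ‖u‖ ≤ 2 * r) : cutoff r u = 1 := by
  have hr' : (0 : ℝ) < r := by exact_mod_cast hr
  have : ‖u‖ / r ≤ 2 := by rwa [div_le_iff₀ hr']
  rw [cutoff, min_eq_left (by linarith), max_eq_right zero_le_one]

theorem norm_lt_of_cutoff_ne_zero {r : ℕ} (hr : 1 ≤ r) {u : Site} (hu : cutoff r u ≠ 0) :
    ‖u‖ < 3 * r := by
  have hr' : (0 : ℝ) < r := by exact_mod_cast hr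
  by_contra! h
  refine hu ?_
  have : 3 ≤ ‖u‖ / r := by rwa [le_div_iff₀ hr']
  rw [cutoff, max_eq_left]
  exact (min_le_right _ _).trans (by linarith)

theorem abs_cutoff_sub_le {r : ℕ} (hr : 1 ≤ r) (u v : Site) :
    |cutoff r u - cutoff r v| ≤ ‖u - v‖ / r := by
  have hr' : (0 : ℝ) < r := by exact_mod_cast hr
  have h1 : |cutoff r u - cutoff r v| ≤ |‖v‖ / r - ‖u‖ / r| := by
    rw [cutoff, cutoff]
    refine (abs_max_sub_max_le_max _ _ _ _).trans (max_le (by simp) ?_)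
    refine (abs_min_sub_min_le_max _ _ _ _).trans (max_le (by simp) (le_of_eq ?_))
    congr 1; ring
  refine h1.trans ?_
  rw [← sub_div, abs_div, abs_of_pos hr', norm_sub_rev u v]
  exact div_le_div_of_nonneg_right (abs_norm_sub_norm_le v u) hr'.le

theorem sq_cutoff_sub_le {β : ℝ} (hβ : 2 ≤ β) {r : ℕ} (hr : 1 ≤ r) (u v : Site) :
    (cutoff r u - cutoff r v) ^ 2 ≤ growth β (u - v) / (r : ℝ) ^ 2 := by
  have hr' : (0 : ℝ) < r := by exact_mod_cast hr
  calc (cutoff r u - cutoff r v) ^ 2 = |cutoff r u - cutoff r v| ^ 2 := (sq_abs _).symm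
    _ ≤ (‖u - v‖ / r) ^ 2 := by gcongr; exact abs_cutoff_sub_le hr u v
    _ = ‖u - v‖ ^ 2 / (r : ℝ) ^ 2 := div_pow _ _ _
    _ ≤ _ := by gcongr; exact sq_norm_le_growth hβ _

end Box

/-! ### Rounding a profile on clusters -/

section Cluster

/-- The maximum of `b` over the clusters of `A`. -/
theorem exists_clusterwise_max {Λ : Finset Site} {A : Finset (Sym2 Site)}
    (hA : ∀ x y, s(x, y) ∈ A → x ∈ Λ) (b : Site → ℝ) :
    ∃ c : Site → ℝ, (∀ u ∈ Λ, ∃ v ∈ Λ, Conn A u v ∧ c u = b v) ∧ (∀ u ∈ Λ, b u ≤ c u) ∧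
      (∀ u ∉ Λ, c u = 0) ∧ ∀ x y, s(x, y) ∈ A → c x = c y := by
  classical
  have hex : ∀ u ∈ Λ, ∃ v ∈ Λ, Conn A u v ∧ ∀ w ∈ Λ, Conn A u w → b w ≤ b v := by
    intro u hu
    obtain ⟨v, hv, hmax⟩ := Finset.exists_max_image (Λ.filter (Conn A u)) b
      ⟨u, Finset.mem_filter.2 ⟨hu, Relation.ReflTransGen.refl⟩⟩
    rw [Finset.mem_filter] at hv
    exact ⟨v, hv.1, hv.2, fun w hw hc => hmax w (Finset.mem_filter.2 ⟨hw, hc⟩)⟩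
  choose! t ht1 ht2 ht3 using hex
  refine ⟨fun u => if u ∈ Λ then b (t u) else 0, fun u hu => ⟨t u, ht1 u hu, ht2 u hu, if_pos hu⟩,
    fun u hu => ?_, fun u hu => if_neg hu, fun x y hxy => ?_⟩
  · simp only [hu, if_true]; exact ht3 u hu u hu Relation.ReflTransGen.refl
  · have hyx : s(y, x) ∈ A := by rwa [Sym2.eq_swap]
    have hx := hA x y hxy
    have hy := hA y x hyx
    simp only [hx, hy, if_true]
    refine le_antisymm (ht3 y hy _ (ht1 x hx) ?_) (ht3 x hx _ (ht1 y hy) ?_)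
    · exact Relation.ReflTransGen.head hyx (ht2 x hx)
    · exact Relation.ReflTransGen.head hxy (ht2 y hy)

end Cluster

end PlanarSpin

namespace PlanarSpin

/-! ### Expansion around the smoothed interaction -/

/-- The model with the same couplings and another even interaction. -/
def Model.withInteraction (M : Model) (h : Angle → ℝ) (heven : ∀ t, h (-t) = h t) : Model :=
  { M with f := h, f_even := heven }

/-- The edges with both endpoints in `Λ`. -/
noncomputable def innerEdges (Λ : Finset Site) : Finset (Sym2 Site) :=
  Λ.sym2.filter fun e => ¬e.IsDiag

theorem mem_innerEdges {Λ : Finset Site} {x y : Site} :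
    s(x, y) ∈ innerEdges Λ ↔ (x ∈ Λ ∧ y ∈ Λ) ∧ x ≠ y := by
  rw [innerEdges, Finset.mem_filter, Finset.mk_mem_sym2_iff, Sym2.mk_isDiag_iff]

theorem innerEdges_subset (Λ : Finset Site) : (innerEdges Λ : Set (Sym2 Site)) ⊆ edges Λ := by
  intro e he
  induction e with
  | h x y =>
    have h := mem_innerEdges.1 (Finset.mem_coe.1 he)
    exact ⟨by simpa using h.2, x, h.1.1, Sym2.mem_mk_left _ _⟩

/-- The edges with exactly one endpoint in `Λ`. -/
def outerEdges (Λ : Finset Site) : Set (Sym2 Site) := edges Λ \ (innerEdges Λ : Set (Sym2 Site))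

theorem touching_outerEdges {Λ : Finset Site} : ∀ e ∈ outerEdges Λ, ∃ u ∈ Λ, u ∈ e :=
  fun _ h => h.1.2

variable {M M' : Model} {F ε L β : ℝ}

theorem potential_eq (hf : Continuous M.f) (Λ : Finset Site) (θ : Config) :
    potential M Λ θ = ∑ e ∈ innerEdges Λ, edgeTerm M θ e + ∑' e : outerEdges Λ, edgeTerm M θ e := by
  rw [potential, tsum_edgeTerm_split hf touching_edges (innerEdges_subset Λ), outerEdges]
  congr 1
  exact Finset.tsum_subtype' (innerEdges Λ) (edgeTerm M θ)

/-- The term indexed by `A` in the expansion of the Gibbs weight of `M` around the Gibbs weight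
with the interaction inside `Λ` replaced by that of `M'`. -/
noncomputable def expansionWeight (M M' : Model) (Λ : Finset Site) (A : Finset (Sym2 Site))
    (θ : Config) : ℝ :=
  Real.exp (∑ e ∈ innerEdges Λ, edgeTerm M' θ e + ∑' e : outerEdges Λ, edgeTerm M θ e) *
    ∏ e ∈ A, (Real.exp (edgeTerm M θ e - edgeTerm M' θ e) - 1)

theorem sum_expansionWeight (hf : Continuous M.f) (Λ : Finset Site) (θ : Config) :
    ∑ A ∈ (innerEdges Λ).powerset, expansionWeight M M' Λ A θ
      = Real.exp (potential M Λ θ) := by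
  simp only [expansionWeight]
  rw [← Finset.mul_sum, ← Finset.prod_add_one, potential_eq hf]
  simp only [sub_add_cancel]
  rw [← Real.exp_sum, ← Real.exp_add, Finset.sum_sub_distrib]
  congr 1
  ring

theorem edgeTerm_sub_nonneg (hJ : M'.J = M.J) (hle : ∀ t, M'.f t ≤ M.f t) (θ : Config)
    (e : Sym2 Site) : 0 ≤ edgeTerm M θ e - edgeTerm M' θ e := by
  induction e with
  | h x y =>
    rw [edgeTerm_mk, edgeTerm_mk, hJ, ← mul_sub]
    exact mul_nonneg (M.J_nonneg _) (sub_nonneg.2 (hle _))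

theorem edgeTerm_sub_le (hJ : M'.J = M.J) (hle : ∀ t, M.f t ≤ M'.f t + ε) (θ : Config)
    (e : Sym2 Site) : edgeTerm M θ e - edgeTerm M' θ e ≤ ε * M.coupling e := by
  induction e with
  | h x y =>
    rw [edgeTerm_mk, edgeTerm_mk, hJ, ← mul_sub, M.coupling_mk, mul_comm]
    exact mul_le_mul_of_nonneg_right (by linarith [hle (θ x - θ y)]) (M.J_nonneg _)

theorem expansionWeight_nonneg (hJ : M'.J = M.J) (hle : ∀ t, M'.f t ≤ M.f t) (Λ : Finset Site)
    (A : Finset (Sym2 Site)) (θ : Config) : 0 ≤ expansionWeight M M' Λ A θ :=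
  mul_nonneg (Real.exp_pos _).le (Finset.prod_nonneg fun e _ =>
    sub_nonneg.2 (Real.one_le_exp (edgeTerm_sub_nonneg hJ hle θ e)))

theorem exp_sub_one_le_two_mul {x : ℝ} (h0 : 0 ≤ x) (h1 : x ≤ 1) : Real.exp x - 1 ≤ 2 * x := by
  have := Real.abs_exp_sub_one_le (x := x) (by rwa [abs_of_nonneg h0])
  rw [abs_of_nonneg h0] at this
  exact (le_abs_self _).trans this

/-- This pointwise bound, once integrated, is the hypothesis on edge weights in the percolation
estimate. -/
theorem expansionWeight_insert_le (hJ : M'.J = M.J) (hle : ∀ t, M'.f t ≤ M.f t)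
    (hle' : ∀ t, M.f t ≤ M'.f t + ε) {e : Sym2 Site} (he : ε * M.coupling e ≤ 1)
    (Λ : Finset Site) {A : Finset (Sym2 Site)} (heA : e ∉ A) (θ : Config) :
    expansionWeight M M' Λ (insert e A) θ
      ≤ 2 * (ε * M.coupling e) * expansionWeight M M' Λ A θ := by
  have h1 : Real.exp (edgeTerm M θ e - edgeTerm M' θ e) - 1 ≤ 2 * (ε * M.coupling e) := by
    have h0 := edgeTerm_sub_nonneg hJ hle θ e
    have h2 := edgeTerm_sub_le hJ hle' θ e
    exact (exp_sub_one_le_two_mul h0 (h2.trans he)).trans (by linarith)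
  have h2 := expansionWeight_nonneg hJ hle Λ A θ
  have h3 : expansionWeight M M' Λ (insert e A) θ
      = (Real.exp (edgeTerm M θ e - edgeTerm M' θ e) - 1) * expansionWeight M M' Λ A θ := by
    rw [expansionWeight, expansionWeight, Finset.prod_insert heA]
    ring
  rw [h3]
  exact mul_le_mul_of_nonneg_right h1 h2

theorem continuous_expansionWeight (hf : Continuous M.f) (hf' : Continuous M'.f)
    (Λ : Finset Site) (A : Finset (Sym2 Site)) : Continuous (expansionWeight M M' Λ A) := by
  refine (Real.continuous_exp.comp (Continuous.add ?_ ?_)).mul ?_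
  · exact continuous_finsetSum _ fun e _ => continuous_edgeTerm hf' e
  · exact continuous_tsum_edgeTerm hf touching_outerEdges
  · exact continuous_finsetProd _ fun e _ => (Real.continuous_exp.comp
      ((continuous_edgeTerm hf e).sub (continuous_edgeTerm hf' e))).sub continuous_const

/-- The shift of the spins by the angles `c`. -/
noncomputable def shift (c : Site → ℝ) : Config := fun u => (c u : Angle)

open Classical in
/-- Second-order bound for the change of the terms of the expansion under opposite shifts. -/
theorem exp_mul_sq_expansionWeight_le (hJ : M'.J = M.J) (hF : ∀ t, |M.f t| ≤ F)
    (hconv : ∀ (t : Angle) (a : ℝ), -(L * a ^ 2) ≤ M'.f (t + a) + M'.f (t + -a) - 2 * M'.f t)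
    (hL : 0 ≤ L) {Λ : Finset Site} {A : Finset (Sym2 Site)} {c : Site → ℝ}
    (hcA : ∀ x y, s(x, y) ∈ A → c x = c y) (hcΛ : ∀ u ∉ Λ, c u = 0) {Q : ℝ}
    (hQ : ∑ u ∈ Λ, ∑ v ∈ Λ, L * (M.J (u - v) * (c u - c v) ^ 2)
      + ∑ u ∈ Λ, (if c u = 0 then 0 else
          4 * F * ∑' v, if v ∈ Λ then 0 else M.J (u - v)) ≤ Q) (θ : Config) :
    Real.exp (-Q) * expansionWeight M M' Λ A θ ^ 2
      ≤ expansionWeight M M' Λ A (θ + shift c) * expansionWeight M M' Λ A (θ + -shift c) := by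
  have hF0 : 0 ≤ F := (abs_nonneg _).trans (hF 0)
  have hneg : ∀ x y, s(x, y) ∈ A → (-shift c) x = (-shift c) y := fun x y h => by
    simp only [Pi.neg_apply, shift, hcA x y h]
  have hpos : ∀ x y, s(x, y) ∈ A → shift c x = shift c y := fun x y h => by
    simp only [shift, hcA x y h]
  -- The factors of `A` carry the rough part `f - h`; a shift constant along the edges of `A` leaves
  -- them unchanged.
  have hP : ∀ {a : Config}, (∀ x y, s(x, y) ∈ A → a x = a y) →
      ∏ e ∈ A, (Real.exp (edgeTerm M (θ + a) e - edgeTerm M' (θ + a) e) - 1)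
        = ∏ e ∈ A, (Real.exp (edgeTerm M θ e - edgeTerm M' θ e) - 1) := by
    intro a ha
    refine Finset.prod_congr rfl fun e he => ?_
    induction e with
    | h x y => rw [edgeTerm_add_of_const θ (ha x y he), edgeTerm_add_of_const θ (ha x y he)]
  set I : Config → ℝ := fun θ => ∑ e ∈ innerEdges Λ, edgeTerm M' θ e with hI
  set O : Config → ℝ := fun θ => ∑' e : outerEdges Λ, edgeTerm M θ e with hO
  set P := ∏ e ∈ A, (Real.exp (edgeTerm M θ e - edgeTerm M' θ e) - 1)
  have hw : ∀ {a : Config}, (∀ x y, s(x, y) ∈ A → a x = a y) →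
      expansionWeight M M' Λ A (θ + a) = Real.exp (I (θ + a) + O (θ + a)) * P := by
    intro a ha
    rw [expansionWeight, hP ha]
  rw [hw hpos, hw hneg, show expansionWeight M M' Λ A θ = Real.exp (I θ + O θ) * P from rfl]
  -- the inner edges
  set D : Sym2 Site → ℝ := Sym2.lift ⟨fun u v => L * (M.J (u - v) * (c u - c v) ^ 2), fun u v => by
    show L * (M.J (u - v) * (c u - c v) ^ 2) = L * (M.J (v - u) * (c v - c u) ^ 2)
    rw [← neg_sub v u, M.J_neg, ← neg_sub (c v) (c u), neg_sq]⟩ with hD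
  have hDmk : ∀ u v, D s(u, v) = L * (M.J (u - v) * (c u - c v) ^ 2) := fun u v => rfl
  have hD0 : ∀ e, 0 ≤ D e := fun e => by
    induction e with
    | h x y =>
      rw [hDmk]; exact mul_nonneg hL (mul_nonneg (M.J_nonneg _) (sq_nonneg _))
  have hI2 : -∑ u ∈ Λ, ∑ v ∈ Λ, L * (M.J (u - v) * (c u - c v) ^ 2)
      ≤ I (θ + shift c) + I (θ + -shift c) - 2 * I θ := by
    have h1 : ∑ e ∈ innerEdges Λ, D e ≤ ∑ u ∈ Λ, ∑ v ∈ Λ, D s(u, v) :=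
      sum_le_of_touching (fun x y h => (mem_innerEdges.1 h).1.1) hD0
    simp only [hDmk] at h1
    have h2 : ∑ e ∈ innerEdges Λ, -D e ≤ ∑ e ∈ innerEdges Λ,
        (edgeTerm M' (θ + shift c) e + edgeTerm M' (θ + -shift c) e - 2 * edgeTerm M' θ e) := by
      refine Finset.sum_le_sum fun e _ => ?_
      induction e with
      | h x y =>
        have h3 := hconv (θ x - θ y) (c x - c y)
        rw [AddCircle.coe_sub] at h3
        rw [hDmk, edgeTerm_mk, edgeTerm_mk, edgeTerm_mk, hJ]
        have e1 : (θ + shift c) x - (θ + shift c) y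
            = θ x - θ y + ((c x : Angle) - (c y : Angle)) := by
          simp only [Pi.add_apply, shift]; abel
        have e2 : (θ + -shift c) x - (θ + -shift c) y
            = θ x - θ y + -((c x : Angle) - (c y : Angle)) := by
          simp only [Pi.add_apply, Pi.neg_apply, shift]; abel
        rw [e1, e2]
        have := mul_le_mul_of_nonneg_left h3 (M.J_nonneg (x - y))
        linarith
    rw [Finset.sum_neg_distrib, Finset.sum_sub_distrib, Finset.sum_add_distrib,
      ← Finset.mul_sum] at h2
    simp only [hI]
    linarith
  -- the outer edges
  set G : Sym2 Site → ℝ := fun e =>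
    if (∀ v ∈ e, v ∈ Λ) ∨ (∀ v ∈ e, c v = 0) then 0 else 4 * F * M.coupling e with hG
  have hGle : ∀ e, G e ≤ 4 * F * M.coupling e := fun e => by
    simp only [hG]
    split_ifs
    · exact mul_nonneg (by linarith) (M.coupling_nonneg e)
    · exact le_rfl
  have hG0 : ∀ e, 0 ≤ G e := fun e => by
    simp only [hG]
    split_ifs
    · exact le_rfl
    · exact mul_nonneg (by linarith) (M.coupling_nonneg e)
  have hO2 : -∑ u ∈ Λ, (if c u = 0 then 0 else
      4 * F * ∑' v, if v ∈ Λ then 0 else M.J (u - v))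
      ≤ O (θ + shift c) + O (θ + -shift c) - 2 * O θ := by
    obtain ⟨hs, hle⟩ := summable_and_tsum_le_of_touching (touching_outerEdges (Λ := Λ)) hG0
      fun u _ => Summable.of_nonneg_of_le (fun v => hG0 _) (fun v => hGle _)
        ((M.summable_coupling_mk u).mul_left _)
    have s0 := summable_edgeTerm hF (touching_outerEdges (Λ := Λ)) θ
    have s1 := summable_edgeTerm hF (touching_outerEdges (Λ := Λ)) (θ + shift c)
    have s2 := summable_edgeTerm hF (touching_outerEdges (Λ := Λ)) (θ + -shift c)
    have h1 : O (θ + shift c) + O (θ + -shift c) - 2 * O θ = ∑' e : outerEdges Λ,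
        (edgeTerm M (θ + shift c) e + edgeTerm M (θ + -shift c) e - 2 * edgeTerm M θ e) := by
      rw [(s1.add s2).tsum_sub (s0.mul_left 2), s1.tsum_add s2, tsum_mul_left]
    have h2 : ∀ e : outerEdges Λ, ‖edgeTerm M (θ + shift c) e + edgeTerm M (θ + -shift c) e
        - 2 * edgeTerm M θ e‖ ≤ G e := by
      rintro ⟨e, he⟩
      rw [Real.norm_eq_abs]
      simp only [hG]
      split_ifs with h
      · rcases h with h | h
        · refine absurd ?_ he.2
          induction e with
          | h x y =>
            refine mem_innerEdges.2 ⟨⟨h x (by simp), h y (by simp)⟩, ?_⟩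
            have := he.1.1
            simpa using this
        · induction e with
          | h x y =>
            have hxy : c x = c y := by rw [h x (by simp), h y (by simp)]
            rw [edgeTerm_add_of_const θ (show shift c x = shift c y by simp only [shift, hxy]),
              edgeTerm_add_of_const θ (show (-shift c) x = (-shift c) y by
                simp only [Pi.neg_apply, shift, hxy])]
            rw [← two_mul, sub_self, abs_zero]
      · have h3 := abs_le.1 (abs_edgeTerm_le hF (θ + shift c) e)
        have h4 := abs_le.1 (abs_edgeTerm_le hF (θ + -shift c) e)
        have h5 := abs_le.1 (abs_edgeTerm_le hF θ e)
        rw [abs_le]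
        constructor <;> linarith
    have h3 := (abs_le.1 (tsum_of_norm_bounded hs.hasSum h2)).1
    have h4 : ∑ u ∈ Λ, ∑' v, G s(u, v) ≤ ∑ u ∈ Λ, (if c u = 0 then 0 else
        4 * F * ∑' v, if v ∈ Λ then 0 else M.J (u - v)) := by
      refine Finset.sum_le_sum fun u hu => le_of_eq ?_
      have h5 : ∀ v, G s(u, v) = if c u = 0 then 0 else
          4 * F * if v ∈ Λ then 0 else M.J (u - v) := by
        intro v
        simp only [hG, Sym2.mem_iff, forall_eq_or_imp, forall_eq, hu, true_and, M.coupling_mk]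
        by_cases hv : v ∈ Λ
        · simp [hv]
        · simp [hv, hcΛ v hv]
      simp only [h5]
      split_ifs
      · exact tsum_zero
      · exact tsum_mul_left
    rw [h1]
    linarith
  rw [mul_pow, ← Real.exp_nat_mul, ← mul_assoc, ← Real.exp_add]
  rw [mul_mul_mul_comm, ← Real.exp_add, ← sq]
  refine mul_le_mul_of_nonneg_right (Real.exp_le_exp.2 ?_) (sq_nonneg _)
  push_cast
  linarith

end PlanarSpin

/-! ### Cost of the shifts and contraction in a box -/

namespace PlanarSpin

variable {M M' : Model} {F ε L β : ℝ}

open Classical in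
/-- Bound on the second-order energy cost of a shift that is constant on the clusters of `A`. -/
theorem shift_cost_le (hβ : 0 ≤ β) (hs : Summable fun x => M.J x * growth β x) (hL : 0 ≤ L)
    (hF : 0 ≤ F) {Λ : Finset Site} {A : Finset (Sym2 Site)} {b c : Site → ℝ} {κ : ℝ} (hκ : 0 ≤ κ)
    (hb : ∀ u v, (b u - b v) ^ 2 ≤ κ * growth β (u - v))
    (hT : ∀ u ∈ Λ, ∀ v ∈ Λ, b v ≠ 0 → ∑' y, (if y ∈ Λ then 0 else M.J (u - y))
      ≤ moment M β * (κ * growth β (u - v)))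
    (hc : ∀ u ∈ Λ, ∃ v ∈ Λ, Conn A u v ∧ c u = b v) :
    ∑ u ∈ Λ, ∑ v ∈ Λ, L * (M.J (u - v) * (Real.pi * c u - Real.pi * c v) ^ 2)
      + ∑ u ∈ Λ, (if Real.pi * c u = 0 then 0 else
          4 * F * ∑' v, if v ∈ Λ then 0 else M.J (u - v))
      ≤ 3 * L * Real.pi ^ 2 * moment M β * (κ * Λ.card)
        + (6 * L * Real.pi ^ 2 + 4 * F) * moment M β *
          (κ * ∑ u ∈ Λ, ∑ v ∈ Λ, growth β (u - v) * if Conn A u v then 1 else 0) := by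
  set W := moment M β
  have hW : 0 ≤ W := moment_nonneg
  -- `X u` dominates `κ * growth β (u - v)` for each `v` in the cluster of `u`, hence both the
  -- rounding error `(c u - b u) ^ 2` and, where `c u ≠ 0`, the coupling to the exterior up to the
  -- factor `moment M β`.
  set X : Site → ℝ := fun u => κ * ∑ v ∈ Λ, growth β (u - v) * if Conn A u v then 1 else 0
  have hterm : ∀ u v, 0 ≤ growth β (u - v) * if Conn A u v then (1 : ℝ) else 0 := fun u v =>
    mul_nonneg (growth_pos _).le (by split_ifs <;> norm_num)
  have hX0 : ∀ u, 0 ≤ X u := fun u => mul_nonneg hκ (Finset.sum_nonneg fun v _ => hterm u v)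
  have hXge : ∀ u, ∀ v ∈ Λ, Conn A u v → κ * growth β (u - v) ≤ X u := by
    intro u v hv huv
    refine mul_le_mul_of_nonneg_left ?_ hκ
    have := Finset.single_le_sum (f := fun v => growth β (u - v) * if Conn A u v then 1 else 0)
      (fun v _ => hterm u v) hv
    simpa [huv] using this
  have hcb : ∀ u ∈ Λ, (c u - b u) ^ 2 ≤ X u := by
    intro u hu
    obtain ⟨v, hv, huv, hcv⟩ := hc u hu
    rw [hcv, ← neg_sub, neg_sq]
    exact (hb u v).trans (hXge u v hv huv)
  have hpair : ∀ u ∈ Λ, ∀ v ∈ Λ, L * (M.J (u - v) * (Real.pi * c u - Real.pi * c v) ^ 2)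
      ≤ 3 * L * Real.pi ^ 2 * (κ * (M.J (u - v) * growth β (u - v)) + M.J (u - v) * X u
        + M.J (u - v) * X v) := by
    intro u hu v hv
    have h1 : (c u - c v) ^ 2 ≤ 3 * (κ * growth β (u - v) + X u + X v) := by
      have := hcb u hu
      have := hcb v hv
      have := hb u v
      nlinarith [sq_nonneg ((c u - b u) - (b u - b v)), sq_nonneg ((c u - b u) + (c v - b v)),
        sq_nonneg ((b u - b v) + (c v - b v))]
    have h2 : (Real.pi * c u - Real.pi * c v) ^ 2 = Real.pi ^ 2 * (c u - c v) ^ 2 := by ring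
    rw [h2]
    have h3 := mul_le_mul_of_nonneg_left h1
      (mul_nonneg (mul_nonneg hL (M.J_nonneg (u - v))) (sq_nonneg Real.pi))
    linarith
  have hJsum : ∀ u, ∑ v ∈ Λ, M.J (u - v) ≤ W := sum_coupling_le_moment hβ hs Λ
  have hJsum' : ∀ v, ∑ u ∈ Λ, M.J (u - v) ≤ W := fun v => by
    refine le_of_eq_of_le (Finset.sum_congr rfl fun u _ => ?_) (hJsum v)
    rw [← neg_sub, M.J_neg]
  have hA1 : ∑ u ∈ Λ, ∑ v ∈ Λ, M.J (u - v) * growth β (u - v) ≤ Λ.card * W := by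
    refine (Finset.sum_le_sum fun u _ => sum_mul_growth_le hs Λ u).trans (le_of_eq ?_)
    rw [Finset.sum_const, nsmul_eq_mul]
  have hA2 : ∑ u ∈ Λ, ∑ v ∈ Λ, M.J (u - v) * X u ≤ W * ∑ u ∈ Λ, X u := by
    rw [Finset.mul_sum]
    refine Finset.sum_le_sum fun u _ => ?_
    rw [← Finset.sum_mul]
    exact mul_le_mul_of_nonneg_right (hJsum u) (hX0 u)
  have hA3 : ∑ u ∈ Λ, ∑ v ∈ Λ, M.J (u - v) * X v ≤ W * ∑ u ∈ Λ, X u := by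
    rw [Finset.sum_comm, Finset.mul_sum]
    refine Finset.sum_le_sum fun v _ => ?_
    rw [← Finset.sum_mul]
    exact mul_le_mul_of_nonneg_right (hJsum' v) (hX0 v)
  have hin : ∑ u ∈ Λ, ∑ v ∈ Λ, L * (M.J (u - v) * (Real.pi * c u - Real.pi * c v) ^ 2)
      ≤ 3 * L * Real.pi ^ 2 * (κ * (Λ.card * W) + W * ∑ u ∈ Λ, X u + W * ∑ u ∈ Λ, X u) := by
    refine (Finset.sum_le_sum fun u hu => Finset.sum_le_sum fun v hv => hpair u hu v hv).trans ?_
    have hexp : ∑ u ∈ Λ, ∑ v ∈ Λ, 3 * L * Real.pi ^ 2 * (κ * (M.J (u - v) * growth β (u - v))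
          + M.J (u - v) * X u + M.J (u - v) * X v)
        = 3 * L * Real.pi ^ 2 * (κ * ∑ u ∈ Λ, ∑ v ∈ Λ, M.J (u - v) * growth β (u - v)
          + ∑ u ∈ Λ, ∑ v ∈ Λ, M.J (u - v) * X u + ∑ u ∈ Λ, ∑ v ∈ Λ, M.J (u - v) * X v) := by
      rw [Finset.mul_sum Λ _ κ, ← Finset.sum_add_distrib, ← Finset.sum_add_distrib, Finset.mul_sum]
      refine Finset.sum_congr rfl fun u _ => ?_
      rw [Finset.mul_sum Λ _ κ, ← Finset.sum_add_distrib, ← Finset.sum_add_distrib, Finset.mul_sum]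
    rw [hexp]
    have h0 : 0 ≤ 3 * L * Real.pi ^ 2 := by positivity
    refine mul_le_mul_of_nonneg_left ?_ h0
    have := mul_le_mul_of_nonneg_left hA1 hκ
    linarith
  have hout : ∑ u ∈ Λ, (if Real.pi * c u = 0 then 0 else
      4 * F * ∑' v, if v ∈ Λ then 0 else M.J (u - v)) ≤ 4 * F * (W * ∑ u ∈ Λ, X u) := by
    rw [Finset.mul_sum, Finset.mul_sum]
    refine Finset.sum_le_sum fun u hu => ?_
    split_ifs with h
    · exact mul_nonneg (by linarith) (mul_nonneg hW (hX0 u))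
    · obtain ⟨v, hv, huv, hcv⟩ := hc u hu
      have hbv : b v ≠ 0 := fun h0 => h (by rw [hcv, h0, mul_zero])
      refine mul_le_mul_of_nonneg_left ((hT u hu v hv hbv).trans ?_) (by linarith)
      exact mul_le_mul_of_nonneg_left (hXge u v hv huv) hW
  have hXsum : ∑ u ∈ Λ, X u
      = κ * ∑ u ∈ Λ, ∑ v ∈ Λ, growth β (u - v) * if Conn A u v then 1 else 0 := by
    rw [Finset.mul_sum]
  rw [← hXsum]
  linarith

theorem glue_add_shift {Λ : Finset Site} {a : Config} (ha : ∀ u ∉ Λ, a u = 0) (η : Config)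
    (ζ : Λ → Angle) : glue Λ η (ζ + fun u : Λ => a u) = glue Λ η ζ + a := by
  funext u
  by_cases hu : u ∈ Λ
  · rw [glue_of_mem hu, Pi.add_apply, Pi.add_apply, glue_of_mem hu]
  · rw [glue_of_notMem hu, Pi.add_apply, glue_of_notMem hu, ha u hu, add_zero]

/-- Averaging the contraction factors over the terms of the expansion. -/
theorem sum_mul_exp_ge {ι : Type*} (s : Finset ι) {Z Q : ι → ℝ} {q : ℝ} (hZ : ∀ i ∈ s, 0 ≤ Z i)
    (hQ : ∑ i ∈ s, Z i * Q i ≤ q * ∑ i ∈ s, Z i) :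
    Real.exp (-q / 2) * ∑ i ∈ s, Z i ≤ ∑ i ∈ s, Z i * Real.exp (-Q i / 2) := by
  have h1 : ∀ i ∈ s, Real.exp (-q / 2) * (Z i * (1 + q / 2) - Z i * Q i / 2)
      ≤ Z i * Real.exp (-Q i / 2) := by
    intro i hi
    -- Jensen's inequality through the tangent line of the exponential at the bound `q` on the mean
    -- of `Q`.
    have h2 := Real.add_one_le_exp (q / 2 - Q i / 2)
    have h3 : Real.exp (-Q i / 2) = Real.exp (-q / 2) * Real.exp (q / 2 - Q i / 2) := by
      rw [← Real.exp_add]; congr 1; ring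
    rw [h3]
    have := mul_le_mul_of_nonneg_left h2 (mul_nonneg (hZ i hi) (Real.exp_pos (-q / 2)).le)
    linarith
  refine le_trans ?_ (Finset.sum_le_sum h1)
  rw [← Finset.mul_sum]
  refine mul_le_mul_of_nonneg_left ?_ (Real.exp_pos _).le
  rw [Finset.sum_sub_distrib, ← Finset.sum_mul, ← Finset.sum_div]
  linarith

/-- Contraction of the mean of an almost odd function in a box, uniformly in the boundary
condition and in the size of the box. -/
theorem exists_contraction (hf : Continuous M.f) (hβ : 2 ≤ β)
    (hs : Summable fun x => M.J x * growth β x) :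
    ∃ q : ℝ, 0 ≤ q ∧ ∀ r : ℕ, 1 ≤ r → ∀ φ : Config → ℝ, Measurable φ → ∀ m ε' : ℝ,
      (∀ θ, |φ θ| ≤ m) →
      (∀ a : Config, (∀ u ∈ box (2 * r), a u = (Real.pi : Angle)) → (∀ u ∉ box (4 * r), a u = 0) →
        ∀ θ, |φ (θ + a) + φ θ| ≤ ε') →
      ∀ η, |gibbsMean M (box (4 * r)) φ η| ≤ m * (1 - Real.exp (-q / 2) / 2) + ε' / 2 := by
  classical
  have hβ0 : 0 ≤ β := by linarith
  set W := moment M β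
  have hW : 0 ≤ W := moment_nonneg
  -- Small enough that the edge weights `2 * ε * J` satisfy the subcriticality condition with `1 /
  -- 2`, and that `ε * J ≤ 1`.
  set ε := 1 / (4 * (W + 1)) with hε
  have hε0 : 0 < ε := by positivity
  have hεW : ε * W ≤ 1 / 4 := by
    rw [hε, div_mul_eq_mul_div, div_le_div_iff₀ (by positivity) (by norm_num)]; linarith
  obtain ⟨F, hF0, hF⟩ := exists_bound_of_continuous hf
  obtain ⟨h, L, hL, hh, heven, happrox, hconv⟩ := exists_semiconvex_approx hf M.f_even hε0
  set M' := M.withInteraction h heven with hM'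
  have hJ : M'.J = M.J := rfl
  set q := 3 * L * Real.pi ^ 2 * W * 81 + (6 * L * Real.pi ^ 2 + 4 * F) * W * (81 * 2) with hq
  have hK : 0 ≤ (6 * L * Real.pi ^ 2 + 4 * F) * W := by positivity
  refine ⟨q, by positivity, fun r hr φ hφ m ε' hm hodd η => ?_⟩
  have hr' : (1 : ℝ) ≤ r := by exact_mod_cast hr
  have hr0 : (0 : ℝ) < r := by linarith
  set Λ := box (4 * r) with hΛ
  -- The squared slope of the cutoff. The box has at most `81 * r ^ 2` sites, so `κ` times the
  -- volume is bounded: this scale invariance of the Dirichlet energy is where dimension two enters.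
  set κ : ℝ := 1 / (r : ℝ) ^ 2 with hκ
  have hκ0 : 0 ≤ κ := by positivity
  have hκΛ : κ * Λ.card ≤ 81 := by
    have := card_box_le (r := r) (k := 4) hr
    rw [hκ, div_mul_eq_mul_div, div_le_iff₀ (by positivity)]
    norm_num at this ⊢
    linarith
  set w : Finset (Sym2 Site) → (Λ → Angle) → ℝ := fun A ζ => expansionWeight M M' Λ A (glue Λ η ζ)
    with hw
  have hwc : ∀ A, Continuous (w A) := fun A =>
    (continuous_expansionWeight hf hh Λ A).comp (continuous_glue Λ η)
  have hwi : ∀ A, Integrable (w A) (haarIn Λ) := fun A => integrable_haarIn (hwc A)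
  have hw0 : ∀ A ζ, 0 ≤ w A ζ := fun A ζ =>
    expansionWeight_nonneg hJ (fun t => (happrox t).1) Λ A _
  set Z : Finset (Sym2 Site) → ℝ := fun A => ∫ ζ, w A ζ ∂haarIn Λ with hZ
  have hZ0 : ∀ A, 0 ≤ Z A := fun A => integral_nonneg (hw0 A)
  set E := innerEdges Λ
  set Q : Finset (Sym2 Site) → ℝ := fun A => 3 * L * Real.pi ^ 2 * W * 81
    + (6 * L * Real.pi ^ 2 + 4 * F) * W *
      (κ * ∑ u ∈ Λ, ∑ v ∈ Λ, growth β (u - v) * if Conn A u v then 1 else 0) with hQ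
  have hQ0 : ∀ A, 0 ≤ Q A := fun A => by
    have : 0 ≤ ∑ u ∈ Λ, ∑ v ∈ Λ, growth β (u - v) * if Conn A u v then (1 : ℝ) else 0 :=
      Finset.sum_nonneg fun u _ => Finset.sum_nonneg fun v _ =>
        mul_nonneg (growth_pos _).le (by split_ifs <;> norm_num)
    positivity
  -- the expected cost of the shifts
  have hZQ : ∑ A ∈ E.powerset, Z A * Q A ≤ q * ∑ A ∈ E.powerset, Z A := by
    have hconn : ∀ u ∈ Λ, ∑ v ∈ Λ, growth β (u - v) * connWeight E Z u v
        ≤ 2 * ∑ A ∈ E.powerset, Z A := by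
      intro u hu
      refine sum_mul_connWeight_le (p := fun x y => 2 * (ε * M.J (x - y)))
        (d := fun x y => growth β (x - y)) hZ0
        (fun x y hxy => (mem_innerEdges.1 hxy).1.2) (fun x y => ?_) (fun x y A _ hA => ?_)
        (fun x y => (growth_pos _).le) (fun x => ?_) (fun x y z => ?_) (fun x => ?_) hu
      · exact mul_nonneg zero_le_two (mul_nonneg hε0.le (M.J_nonneg _))
      · rw [hZ, ← integral_const_mul]
        refine integral_mono (hwi _) ((hwi _).const_mul _) fun ζ => ?_
        refine expansionWeight_insert_le hJ (fun t => (happrox t).1) (fun t => (happrox t).2)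
          ?_ Λ hA _
        have := mul_le_mul_of_nonneg_left (coupling_le_moment hβ0 hs (x - y)) hε0.le
        rw [M.coupling_mk]; linarith
      · rw [sub_self, growth_zero]
      · rw [← sub_add_sub_cancel x y z]; exact growth_add_le hβ0 _ _
      · have h1 := mul_le_mul_of_nonneg_left (sum_mul_growth_le hs Λ x) hε0.le
        calc ∑ y ∈ Λ, 2 * (ε * M.J (x - y)) * growth β (x - y)
            = 2 * (ε * ∑ y ∈ Λ, M.J (x - y) * growth β (x - y)) := by
              rw [Finset.mul_sum, Finset.mul_sum]
              exact Finset.sum_congr rfl fun y _ => by ring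
          _ ≤ 1 / 2 := by linarith
    have hsum : ∑ A ∈ E.powerset, Z A *
          ∑ u ∈ Λ, ∑ v ∈ Λ, growth β (u - v) * (if Conn A u v then 1 else 0)
        = ∑ u ∈ Λ, ∑ v ∈ Λ, growth β (u - v) * connWeight E Z u v := by
      simp only [connWeight, Finset.mul_sum]
      rw [Finset.sum_comm]
      refine Finset.sum_congr rfl fun u _ => ?_
      rw [Finset.sum_comm]
      refine Finset.sum_congr rfl fun v _ => Finset.sum_congr rfl fun A _ => ?_
      split_ifs <;> ring
    have hcs := Finset.sum_le_sum hconn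
    rw [Finset.sum_const, nsmul_eq_mul, ← hsum] at hcs
    set Zt := ∑ A ∈ E.powerset, Z A with hZt
    have hZt0 : 0 ≤ Zt := Finset.sum_nonneg fun A _ => hZ0 A
    have hexp : ∑ A ∈ E.powerset, Z A * Q A = 3 * L * Real.pi ^ 2 * W * 81 * Zt
        + (6 * L * Real.pi ^ 2 + 4 * F) * W * (κ * ∑ A ∈ E.powerset, Z A *
          ∑ u ∈ Λ, ∑ v ∈ Λ, growth β (u - v) * (if Conn A u v then 1 else 0)) := by
      rw [hZt, Finset.mul_sum, Finset.mul_sum _ _ κ,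
        Finset.mul_sum _ _ (_ * W), ← Finset.sum_add_distrib]
      exact Finset.sum_congr rfl fun A _ => by simp only [hQ]; ring
    have hqZ : q * Zt = 3 * L * Real.pi ^ 2 * W * 81 * Zt
        + (6 * L * Real.pi ^ 2 + 4 * F) * W * (81 * 2 * Zt) := by rw [hq]; ring
    rw [hexp, hqZ]
    refine add_le_add le_rfl (mul_le_mul_of_nonneg_left ?_ hK)
    have h1 := mul_le_mul_of_nonneg_left hcs hκ0
    have h2 := mul_le_mul_of_nonneg_right hκΛ (mul_nonneg zero_le_two hZt0)
    linarith
  -- the contraction for each term of the expansion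
  have hterm : ∀ A ∈ E.powerset, |∫ ζ, φ (glue Λ η ζ) * w A ζ ∂haarIn Λ|
      ≤ (m * (1 - Real.exp (-Q A / 2) / 2) + ε' / 2) * Z A := by
    intro A hA
    have hAE := Finset.mem_powerset.1 hA
    obtain ⟨c, hc1, hc2, hc3, hc4⟩ := exists_clusterwise_max
      (fun x y hxy => (mem_innerEdges.1 (hAE hxy)).1.1) (cutoff r)
    set a := shift fun u => Real.pi * c u with ha
    have ha0 : ∀ u ∉ Λ, a u = 0 := fun u hu => by
      simp only [ha, shift, hc3 u hu, mul_zero, AddCircle.coe_zero]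
    have hna0 : ∀ u ∉ Λ, (-a) u = 0 := fun u hu => by rw [Pi.neg_apply, ha0 u hu, neg_zero]
    have hapi : ∀ u ∈ box (2 * r), a u = (Real.pi : Angle) := by
      intro u hu
      -- The cutoff attains its maximum `1` here, so taking cluster maxima cannot change it.
      have hu' : u ∈ Λ := box_mono (by omega) hu
      have h1 : cutoff r u = 1 := cutoff_eq_one hr (by simpa using mem_box.1 hu)
      obtain ⟨v, -, -, hv⟩ := hc1 u hu'
      have h2 : c u = 1 := le_antisymm (hv ▸ cutoff_le_one r v) (h1 ▸ hc2 u hu')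
      simp only [ha, shift, h2, mul_one]
    -- As `-π = π` modulo `2π`, both opposite shifts make `φ` almost odd.
    have hnapi : ∀ u ∈ box (2 * r), (-a) u = (Real.pi : Angle) := fun u hu => by
      rw [Pi.neg_apply, hapi u hu]; exact Real.Angle.neg_coe_pi
    have hnshift : (-fun u : Λ => a u) = fun u : Λ => (-a) u := rfl
    refine abs_integral_mul_le_of_shift (haarIn Λ) (a := fun u : Λ => a u) (hQ0 A) (hwi A) (hw0 A)
      (hφ.comp (measurable_glue Λ η)).aestronglyMeasurable (fun ζ => hm _)
      (fun ζ => ?_) (fun ζ => ?_) (fun ζ => ?_)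
    · rw [glue_add_shift ha0]; exact hodd a hapi ha0 _
    · rw [hnshift, glue_add_shift hna0]; exact hodd (-a) hnapi hna0 _
    · simp only [hw]
      rw [hnshift, glue_add_shift ha0, glue_add_shift hna0]
      refine exp_mul_sq_expansionWeight_le hJ hF hconv hL (fun x y hxy => ?_) (fun u hu => ?_)
        ?_ _
      · rw [hc4 x y hxy]
      · rw [hc3 u hu, mul_zero]
      · refine (shift_cost_le hβ0 hs hL hF0.le hκ0 (fun u v => ?_) (fun u _ v _ hv => ?_)
          hc1).trans ?_
        · rw [hκ, one_div_mul_eq_div]; exact sq_cutoff_sub_le hβ hr u v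
        · rw [mul_comm]
          refine tsum_coupling_le hs u (mul_nonneg hκ0 (growth_pos _).le) fun y hy => ?_
          have hv' := norm_lt_of_cutoff_ne_zero hr hv
          have hy' : (4 : ℝ) * r < ‖y‖ := by
            by_contra! h
            exact hy (mem_box.2 (by push_cast; exact h))
          have hvy : (r : ℝ) ≤ ‖v - y‖ := by
            have := norm_sub_norm_le y v
            rw [norm_sub_rev] at this
            linarith
          -- The cluster of `u` contains `v` within radius `3r`, while `y` lies beyond `4r`.
          -- Submultiplicativity splits this gap: either `u` is far from `v`, paid by the
          -- connectivity, or the coupling from `u` to `y` is long.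
          have h1 : (r : ℝ) ^ 2 ≤ growth β (v - y) :=
            le_trans (by gcongr) (sq_norm_le_growth hβ _)
          have h2 := growth_add_le hβ0 (v - u) (u - y)
          rw [sub_add_sub_cancel, ← neg_sub u v, growth_neg] at h2
          rw [hκ, mul_assoc, one_div_mul_eq_div, le_div_iff₀ (by positivity), one_mul]
          linarith
        · simp only [hQ]
          have : 0 ≤ 3 * L * Real.pi ^ 2 * W := by positivity
          exact add_le_add (mul_le_mul_of_nonneg_left hκΛ this) le_rfl
  -- summation over the expansion
  have hsumw : ∀ ζ, gibbsWeight M Λ η ζ = ∑ A ∈ E.powerset, w A ζ := fun ζ =>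
    (sum_expansionWeight hf Λ _).symm
  have hZtot : ∫ ζ, gibbsWeight M Λ η ζ ∂haarIn Λ = ∑ A ∈ E.powerset, Z A := by
    simp only [hsumw]
    exact integral_finsetSum _ fun A _ => hwi A
  have hnum : ∫ ζ, φ (glue Λ η ζ) * gibbsWeight M Λ η ζ ∂haarIn Λ
      = ∑ A ∈ E.powerset, ∫ ζ, φ (glue Λ η ζ) * w A ζ ∂haarIn Λ := by
    simp only [hsumw, Finset.mul_sum]
    exact integral_finsetSum _ fun A _ => (hwi A).bdd_mul
      (hφ.comp (measurable_glue Λ η)).aestronglyMeasurable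
      (Filter.Eventually.of_forall fun ζ => hm _)
  have hpos := integral_gibbsWeight_pos hf Λ η
  have hm0 : 0 ≤ m := (abs_nonneg _).trans (hm 0)
  rw [gibbsMean, abs_div, abs_of_pos hpos, div_le_iff₀ hpos, hnum, hZtot]
  refine (Finset.abs_sum_le_sum_abs _ _).trans ((Finset.sum_le_sum hterm).trans ?_)
  have hE := sum_mul_exp_ge E.powerset (fun A _ => hZ0 A) hZQ
  have hrw : ∑ A ∈ E.powerset, (m * (1 - Real.exp (-Q A / 2) / 2) + ε' / 2) * Z A
      = (m + ε' / 2) * ∑ A ∈ E.powerset, Z A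
        - m / 2 * ∑ A ∈ E.powerset, Z A * Real.exp (-Q A / 2) := by
    rw [Finset.mul_sum, Finset.mul_sum, ← Finset.sum_sub_distrib]
    exact Finset.sum_congr rfl fun A _ => by ring
  rw [hrw]
  have := mul_le_mul_of_nonneg_left hE (div_nonneg hm0 zero_le_two)
  linarith

end PlanarSpin

/-! ### Recursion over scales -/

namespace PlanarSpin

variable {M : Model}

/-- The spin-spin correlation observable. -/
noncomputable def spinProduct (x : Site) (θ : Config) : ℝ := Real.Angle.cos (θ 0 - θ x)

theorem measurable_spinProduct (x : Site) : Measurable (spinProduct x) := by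
  have h : Continuous fun θ : Config => θ 0 - θ x :=
    (continuous_apply (0 : Site)).sub (continuous_apply x)
  exact (Real.Angle.continuous_cos.comp h).measurable

theorem abs_spinProduct_le (x : Site) (θ : Config) : |spinProduct x θ| ≤ 1 := by
  rw [spinProduct]
  generalize θ 0 - θ x = t
  induction t using QuotientAddGroup.induction_on with
  | H z => exact Real.abs_cos_le_one z

theorem spinProduct_add {x : Site} {a : Config} (h0 : a 0 = (Real.pi : Angle)) (hx : a x = 0)
    (θ : Config) : spinProduct x (θ + a) = -spinProduct x θ := by
  rw [spinProduct, spinProduct, Pi.add_apply, Pi.add_apply, h0, hx, add_zero, add_sub_right_comm]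
  exact Real.Angle.cos_add_pi _

/-- One step of the recursion over scales for the correlation in a box. -/
theorem exists_scale_step (hf : Continuous M.f) {s : ℝ} (hs0 : 0 < s)
    (hs : Summable fun x => M.J x * growth (2 + s) x) :
    ∃ τ C : ℝ, 0 < τ ∧ τ < 1 ∧ 0 ≤ C ∧ ∀ r : ℕ, 1 ≤ r → ∀ x ∉ box (4 * r), ∀ m : ℝ,
      (∀ η, |gibbsMean M (box r) (spinProduct x) η| ≤ m) →
      ∀ η, |gibbsMean M (box (4 * r)) (spinProduct x) η| ≤ τ * m + C * (r : ℝ) ^ (-s) := by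
  obtain ⟨q, hq, hcontr⟩ := exists_contraction hf (by linarith : 2 ≤ 2 + s) hs
  obtain ⟨F, hF0, hF⟩ := exists_bound_of_continuous hf
  set W := moment M (2 + s)
  have hW : 0 ≤ W := moment_nonneg
  have hexp1 : Real.exp (-q / 2) ≤ 1 := Real.exp_le_one_iff.2 (by linarith)
  have hexp0 := Real.exp_pos (-q / 2)
  refine ⟨1 - Real.exp (-q / 2) / 2, 18 * F * W * Real.exp (36 * F * W), by linarith, by linarith,
    by positivity, fun r hr x hx m hm η => ?_⟩
  have hr1 : (1 : ℝ) ≤ r := by exact_mod_cast hr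
  have hr0 : (0 : ℝ) < r := by linarith
  have hsub : box r ⊆ box (4 * r) := box_mono (by omega)
  have hsub2 : box r ⊆ box (2 * r) := box_mono (by omega)
  rw [← gibbsMean_gibbsMean hf hsub (measurable_spinProduct x) (abs_spinProduct_le x)]
  set δ := 18 * F * W * (r : ℝ) ^ (-s) with hδ
  have hrs1 : (r : ℝ) ^ (-s) ≤ 1 := Real.rpow_le_one_of_one_le_of_nonpos hr1 (by linarith)
  have hrs0 : 0 < (r : ℝ) ^ (-s) := Real.rpow_pos_of_pos hr0 _
  have hδ0 : 0 ≤ δ := by positivity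
  -- At most `9 * r ^ 2` sites, each with coupling at most `W * r ^ (-(2 + s))` beyond distance `r`:
  -- this gives the `18` and the exponent `-s`.
  have htail : ∑ u ∈ box r, ∑' v, (if v ∈ box (2 * r) then 0 else 2 * F * M.J (u - v)) ≤ δ := by
    have h1 : ∀ u ∈ box r, ∑' v, (if v ∈ box (2 * r) then 0 else 2 * F * M.J (u - v))
        ≤ 2 * F * ((r : ℝ) ^ (-(2 + s)) * W) := by
      intro u hu
      have h2 : ∀ v, (if v ∈ box (2 * r) then 0 else 2 * F * M.J (u - v))
          = 2 * F * if v ∈ box (2 * r) then 0 else M.J (u - v) := fun v => by split_ifs <;> ring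
      simp only [h2, tsum_mul_left]
      refine mul_le_mul_of_nonneg_left ?_ (by positivity)
      refine tsum_coupling_le hs u (by positivity) fun v hv => ?_
      have hv' : (2 : ℝ) * r < ‖v‖ := by
        by_contra! h
        exact hv (mem_box.2 (by push_cast; exact h))
      have huv : (r : ℝ) ≤ ‖u - v‖ := by
        have := norm_sub_norm_le v u
        rw [norm_sub_rev] at this
        linarith [mem_box.1 hu]
      have h3 := rpow_le_growth (by linarith : 0 ≤ 2 + s) hr0.le huv
      rw [Real.rpow_neg hr0.le, ← div_eq_inv_mul]
      exact (one_le_div (Real.rpow_pos_of_pos hr0 _)).2 h3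
    refine (Finset.sum_le_sum h1).trans ?_
    rw [Finset.sum_const, nsmul_eq_mul]
    have hc := card_box_le (k := 1) hr
    norm_num at hc
    have h4 : (r : ℝ) ^ (-(2 + s)) * (r : ℝ) ^ 2 = (r : ℝ) ^ (-s) := by
      rw [← Real.rpow_natCast (r : ℝ) 2, ← Real.rpow_add hr0]
      congr 1; push_cast; ring
    have h5 : 0 ≤ 2 * F * ((r : ℝ) ^ (-(2 + s)) * W) := by positivity
    refine (mul_le_mul_of_nonneg_right hc h5).trans (le_of_eq ?_)
    rw [hδ, ← h4]; ring
  have hodd : ∀ a : Config, (∀ u ∈ box (2 * r), a u = (Real.pi : Angle)) →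
      (∀ u ∉ box (4 * r), a u = 0) → ∀ θ, |gibbsMean M (box r) (spinProduct x) (θ + a)
        + gibbsMean M (box r) (spinProduct x) θ| ≤ 2 * (Real.exp δ - 1) * Real.exp δ := by
    intro a ha ha0 θ
    refine abs_gibbsMean_add_le hf (measurable_spinProduct x) (abs_spinProduct_le x)
      (spinProduct_add (ha 0 (zero_mem_box _)) (ha0 x hx)) hδ0 (fun θ => ?_) θ
    exact (abs_potential_add_sub_le hF hsub2
      (fun u hu v hv => by rw [ha u hu, ha v hv]) θ).trans htail
  have hmain := hcontr r hr _ (measurable_gibbsMean hf _ (measurable_spinProduct x)) m _ hm hodd η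
  have herr : 2 * (Real.exp δ - 1) * Real.exp δ / 2
      ≤ 18 * F * W * Real.exp (36 * F * W) * (r : ℝ) ^ (-s) := by
    have h1 : Real.exp δ - 1 ≤ δ * Real.exp δ := by
      have h2 := Real.add_one_le_exp (-δ)
      have h3 := mul_le_mul_of_nonneg_right h2 (Real.exp_pos δ).le
      rw [← Real.exp_add, neg_add_cancel, Real.exp_zero] at h3
      linarith
    have h2 : δ ≤ 18 * F * W := mul_le_of_le_one_right (by positivity) hrs1
    have h3 : Real.exp δ * Real.exp δ ≤ Real.exp (36 * F * W) := by
      rw [← Real.exp_add]; exact Real.exp_le_exp.2 (by linarith)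
    calc 2 * (Real.exp δ - 1) * Real.exp δ / 2 = (Real.exp δ - 1) * Real.exp δ := by ring
      _ ≤ δ * Real.exp δ * Real.exp δ := mul_le_mul_of_nonneg_right h1 (Real.exp_pos δ).le
      _ = δ * (Real.exp δ * Real.exp δ) := by ring
      _ ≤ δ * Real.exp (36 * F * W) := mul_le_mul_of_nonneg_left h3 hδ0
      _ = _ := by rw [hδ]; ring
  linarith

/-- Exponential decay in the scale of the correlations in boxes. -/
theorem exists_geometric_decay (hf : Continuous M.f) {s : ℝ} (hs0 : 0 < s)
    (hs : Summable fun x => M.J x * growth (2 + s) x) :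
    ∃ ρ C : ℝ, 0 < ρ ∧ ρ < 1 ∧ 1 ≤ C ∧ ∀ (n : ℕ), ∀ x ∉ box (4 ^ n), ∀ η,
      |gibbsMean M (box (4 ^ n)) (spinProduct x) η| ≤ C * ρ ^ n := by
  obtain ⟨τ, C, hτ0, hτ1, hC, hstep⟩ := exists_scale_step hf hs0 hs
  set t : ℝ := (4 : ℝ) ^ (-s) with ht
  have ht0 : 0 < t := Real.rpow_pos_of_pos (by norm_num) _
  have ht1 : t < 1 := Real.rpow_lt_one_of_one_lt_of_neg (by norm_num) (by linarith)
  -- Half of the gap `1 - τ` is left to absorb the error `C * t ^ n`; `C'` is chosen so that it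
  -- fits.
  set ρ := max ((1 + τ) / 2) t with hρ
  have hρ0 : 0 < ρ := ht0.trans_le (le_max_right _ _)
  set C' := max 1 (2 * C / (1 - τ)) with hC'
  have hC'1 : 1 ≤ C' := le_max_left _ _
  have hC'2 : C ≤ C' * (1 - τ) / 2 := by
    have h : 2 * C / (1 - τ) ≤ C' := le_max_right _ _
    rw [div_le_iff₀ (by linarith)] at h
    linarith
  refine ⟨ρ, C', hρ0, max_lt (by linarith) ht1, hC'1, fun n => ?_⟩
  induction n with
  | zero =>
    intro x _ η
    rw [pow_zero ρ, mul_one]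
    exact (abs_gibbsMean_le hf _ (abs_spinProduct_le x) η).trans hC'1
  | succ n ih =>
    intro x hx η
    rw [pow_succ'] at hx ⊢
    have hx' : x ∉ box (4 ^ n) := fun h => hx (box_mono (by omega) h)
    refine (hstep (4 ^ n) (Nat.one_le_pow _ _ (by norm_num)) x hx _ (ih x hx') η).trans ?_
    have hpow : ((4 ^ n : ℕ) : ℝ) ^ (-s) = t ^ n := by
      rw [ht, Nat.cast_pow, Nat.cast_ofNat, ← Real.rpow_natCast, ← Real.rpow_natCast,
        ← Real.rpow_mul (by norm_num), ← Real.rpow_mul (by norm_num), mul_comm]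
    rw [hpow]
    have htρ : t ^ n ≤ ρ ^ n := pow_le_pow_left₀ ht0.le (le_max_right _ _) n
    have hρn : 0 < ρ ^ n := pow_pos hρ0 n
    calc τ * (C' * ρ ^ n) + C * t ^ n ≤ τ * (C' * ρ ^ n) + C' * (1 - τ) / 2 * ρ ^ n :=
          add_le_add le_rfl (mul_le_mul hC'2 htρ (pow_pos ht0 n).le (hC.trans hC'2))
      _ = C' * ((1 + τ) / 2 * ρ ^ n) := by ring
      _ ≤ C' * (ρ * ρ ^ n) := by
          refine mul_le_mul_of_nonneg_left ?_ (by linarith)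
          exact mul_le_mul_of_nonneg_right (le_max_left _ _) hρn.le
      _ = C' * ρ ^ (n + 1) := by rw [pow_succ']

end PlanarSpin

/-! ### Polynomial decay -/

theorem theorem1 (M : PlanarSpin.Model) (α J₀ : ℝ) (hα : 4 < α) (hJ₀ : 0 ≤ J₀)
    (hJ : ∀ x : PlanarSpin.Site, x ≠ 0 → M.J x ≤ J₀ * PlanarSpin.oneNorm x ^ (-α))
    (hf : Continuous M.f) :
    ∃ C c : ℝ, 0 < C ∧ 0 < c ∧
      ∀ μ : Measure PlanarSpin.Config, PlanarSpin.IsGibbs M μ →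
        ∀ x : PlanarSpin.Site, x ≠ 0 →
          |∫ θ, Real.Angle.cos (θ 0 - θ x) ∂μ| ≤ c * ‖x‖ ^ (-C) := by
  -- Half of the excess over `4` serves as `s`: the moment of order `2 + s` is then finite because
  -- `4 + s < α`.
  have hs0 : 0 < (α - 4) / 2 := by linarith
  obtain ⟨ρ, B, hρ0, hρ1, hB, hdecay⟩ := PlanarSpin.exists_geometric_decay hf hs0
    (PlanarSpin.summable_mul_growth hJ₀ hJ (by linarith) (by linarith))
  have hlog : 0 < Real.log 4 := Real.log_pos (by norm_num)
  set C := -Real.log ρ / Real.log 4 with hC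
  have hC0 : 0 < C := div_pos (neg_pos.2 (Real.log_neg hρ0 hρ1)) hlog
  have hρC : ρ = (4 : ℝ) ^ (-C) := by
    rw [Real.rpow_def_of_pos (by norm_num), hC, ← neg_div, neg_neg,
      mul_div_cancel₀ _ hlog.ne', Real.exp_log hρ0]
  refine ⟨C, B / ρ ^ 2, hC0, by positivity, fun μ hμ x hx => ?_⟩
  have hx1 := PlanarSpin.one_le_norm hx
  obtain ⟨n, hn1, hn2⟩ := exists_nat_pow_near hx1 (by norm_num : (1 : ℝ) < 4)
  -- As `‖x‖` may equal `4 ^ n`, only the box of radius `4 ^ (n - 1)` surely misses `x`. For `n = 0`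
  -- the truncated exponent is `0` and the trivial bound suffices; the loss is covered by the factor
  -- `ρ ^ 2` in the constant.
  have hbound : |∫ θ, PlanarSpin.spinProduct x θ ∂μ| ≤ B * ρ ^ (n - 1) := by
    cases n with
    | zero =>
      refine hμ.abs_integral_le hf ∅ (PlanarSpin.measurable_spinProduct x)
        (PlanarSpin.abs_spinProduct_le x) fun η => ?_
      refine (PlanarSpin.abs_gibbsMean_le hf _ (PlanarSpin.abs_spinProduct_le x) η).trans ?_
      simpa using hB
    | succ n =>
      refine hμ.abs_integral_le hf _ (PlanarSpin.measurable_spinProduct x)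
        (PlanarSpin.abs_spinProduct_le x) (hdecay n x fun hmem => ?_)
      have h1 := PlanarSpin.mem_box.1 hmem
      push_cast at h1
      have h2 : (4 : ℝ) ^ n < 4 ^ (n + 1) := pow_lt_pow_right₀ (by norm_num) (by omega)
      linarith
  have hpow : ρ ^ (n + 1) ≤ ‖x‖ ^ (-C) := by
    have h1 : ρ ^ (n + 1) = ((4 : ℝ) ^ (n + 1)) ^ (-C) := by
      rw [hρC, ← Real.rpow_natCast, ← Real.rpow_natCast, ← Real.rpow_mul (by norm_num),
        ← Real.rpow_mul (by norm_num), mul_comm]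
    rw [h1]
    exact Real.rpow_le_rpow_of_nonpos (by linarith) hn2.le (by linarith)
  refine hbound.trans ?_
  have hstep : ρ ^ 2 * ρ ^ (n - 1) ≤ ρ ^ (n + 1) := by
    rw [← pow_add]
    exact pow_le_pow_of_le_one hρ0.le hρ1.le (by omega)
  rw [div_mul_eq_mul_div, le_div_iff₀ (by positivity), mul_assoc]
  refine mul_le_mul_of_nonneg_left ?_ (by linarith)
  linarith
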